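/- For words over an alphabet, let the switch count $|w|_s$ of a word $w$ be its length after collapsing each maximal group of consecutive equal symbols to a single symbol. For $n\ge 3$ let $\mathcal{A}_n$ be the deterministic automaton with states $1,\ldots,n$ and alphabet $\{a,b\}$ given by $$1a=1,\quad 1b=2;\qquad (2k)a=2k+1,\quad (2k)b=2k-1\quad \left(1\le k\le \left\lfloor\tfrac{n-1}{2}\right\rfloor\right);$$ $$(2k+1)a=2k,\quad (2k+1)b=2k+2\quad \left(1\le k\le \left\lfloor\tfrac{n-2}{2}\right\rfloor\right);$$ $$na=nb=\begin{cases}\frac n3 & n\equiv 0 \pmod 3,\\ \frac{n+2}3 & n\equiv 1\pmod 3,\\ \frac{n+4}3 & n\equiv 2\pmod 3.\end{cases}$$ Words act from left to right, and a word is synchronizing if it sends all states to one and the same state. Then for every $n\ge 3$: 1. The automaton $\mathcal{A}_n$ is synchronizing, and the minimal switch count of a synchronizing word for $\mathcal{A}_n$ (the switch count of $\mathcal{A}_n$) is exactly $\left\lceil \tfrac23 n(n-2)-1\right\rceil$. In particular every synchronizing word $w$ for $\mathcal{A}_n$ satisfies $|w|_s\ge \left\lceil \tfrac23 n(n-2)-1\right\rceil$.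 2. Among the synchronizing words for $\mathcal{A}_n$ of minimal switch count there is exactly one of shortest length, and its switch count is $\left\lceil \tfrac23 n(n-2)-1\right\rceil$. 3. If $6\mid n$, the unique word in 2 is $$b(ab)^{\frac n3-1}\;\prod_{k=2}^{\frac n3-1}\Bigl(b(ba)^k(ab)^{\frac n3}\Bigr)\; b(ba)^{\frac23 n-1}b\;\prod_{k=\frac n3+1}^{\frac23 n-1}\Bigl((ba)^{n-k}b\Bigr)\; b,$$ where products denote concatenation in order of increasing $k$ and empty products are the empty word. -/

import Mathlib

/-! Synchronizing words, switch counts, and the binary automata `A n`.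
A deterministic finite automaton is given by its transition function `δ : Q → α → Q`
(no initial or final states). -/

namespace SwitchCount

/-- The state `q w` reached from `q` by processing the word `w` from left to right. -/
def run {Q α : Type*} (δ : Q → α → Q) (q : Q) (w : List α) : Q :=
  w.foldl δ q

/-- A word is synchronizing if it sends all states to one and the same state. -/
def IsSynchronizing {Q α : Type*} (δ : Q → α → Q) (w : List α) : Prop :=
  ∃ s : Q, ∀ q : Q, run δ q w = s

/-- The switch count of a word: its length after collapsing each group of consecutive equal
symbols to a single symbol. -/
def wordSwitchCount {α : Type*} [DecidableEq α] : List α → ℕ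
  | [] => 0
  | [_] => 1
  | x :: y :: w =>
      if x = y then wordSwitchCount (y :: w) else 1 + wordSwitchCount (y :: w)

/-- The automaton is synchronizing, and `m` is its switch count, i.e. the minimal switch count of a
synchronizing word. -/
def HasSwitchCount {Q α : Type*} [DecidableEq α] (δ : Q → α → Q) (m : ℕ) : Prop :=
  IsLeast {k : ℕ | ∃ w : List α, IsSynchronizing δ w ∧ wordSwitchCount w = k} m

/-- `w` is a synchronizing word of minimal switch count. -/
def IsMinimal {Q α : Type*} [DecidableEq α] (δ : Q → α → Q) (w : List α) : Prop :=
  IsSynchronizing δ w ∧ ∀ u : List α, IsSynchronizing δ u → wordSwitchCount w ≤ wordSwitchCount u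

/-- `w` is a shortest word among the synchronizing words of minimal switch count. -/
def IsShortestMinimal {Q α : Type*} [DecidableEq α] (δ : Q → α → Q) (w : List α) : Prop :=
  IsMinimal δ w ∧ ∀ u : List α, IsMinimal δ u → w.length ≤ u.length

/-- The binary alphabet. -/
inductive Letter
  | a
  | b
  deriving DecidableEq

/-- The common image of state `n` under both letters. -/
def target (n : ℕ) : ℕ :=
  if n % 3 = 0 then n / 3 else if n % 3 = 1 then (n + 2) / 3 else (n + 4) / 3

/-- The transitions of `A n` on the numbers `1, …, n`: the last state `n` goes to `target n`; below
`n`, the letter `a` fixes `1` and swaps `2k` and `2k+1`, the letter `b` swaps `2k-1` and `2k`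
(where a partner equal to `n` is reached, but not left, in this way). -/
def stepNat (n q : ℕ) : Letter → ℕ
  | .a => if q = n then target n else if q = 1 then 1 else if q % 2 = 0 then q + 1 else q - 1
  | .b => if q = n then target n else if q % 2 = 0 then q - 1 else q + 1

theorem stepNat_mem {n q : ℕ} (x : Letter) (hq : q ∈ Finset.Icc 1 n) :
    stepNat n q x ∈ Finset.Icc 1 n := by
  rw [Finset.mem_Icc] at *
  cases x <;> simp only [stepNat, target] <;> split_ifs <;> omega

/-- The set `{1, …, n}` of states of `A n`. -/
abbrev State (n : ℕ) : Type := {q : ℕ // q ∈ Finset.Icc 1 n}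

/-- The binary automaton `A n`, as a transition function. -/
def A (n : ℕ) (q : State n) (x : Letter) : State n :=
  ⟨stepNat n q.1 x, stepNat_mem x q.2⟩

/-- The `k`-th power `u ^ k` of a word. -/
def wpow (u : List Letter) (k : ℕ) : List Letter :=
  (List.replicate k u).flatten

/-- For `n` divisible by `6`, the word
`b (ab)^(n/3-1) · ∏_{k=2}^{n/3-1} (b (ba)^k (ab)^(n/3)) · b (ba)^(2n/3-1) b ·
∏_{k=n/3+1}^{2n/3-1} ((ba)^(n-k) b) · b`.
Here `List.Ico i j` lists `i, …, j-1` in increasing order. -/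
def explicitWord (n : ℕ) : List Letter :=
  [.b] ++ wpow [.a, .b] (n / 3 - 1)
    ++ (List.Ico 2 (n / 3)).flatMap
        (fun k => [.b] ++ wpow [.b, .a] k ++ wpow [.a, .b] (n / 3))
    ++ [.b] ++ wpow [.b, .a] (2 * n / 3 - 1) ++ [.b]
    ++ (List.Ico (n / 3 + 1) (2 * n / 3)).flatMap
        (fun k => wpow [.b, .a] (n - k) ++ [.b])
    ++ [.b]

end SwitchCount

/-! Set the state `n` aside and put the other M = n - 1 states on the cycle ℤ/M. There `outer` is
the reflection p ↦ -1 - p and `inner` is p ↦ -p, except that `inner` sends position 0 to `n`, from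
where either letter leads to -m, with m = ⌊n/3⌋. Cut a word into blocks inner^(i+1) outer^(k+1),
worth two switches each. The plain block (0, 0) rotates by -1, and the distance of two positions can
change only when one of them is at 0.

Two positions bound two complementary arcs. Lifting to ℤ and comparing images modulo 2M tells which
arc shrinks to a point (`Merges`). Give index k both to an arc around 0 of length m + k and to an
arc avoiding 0 of length k + 1. When an arc around 0 exits with an end at 0, the index drops by one
if the block has i > 0 and is kept otherwise; when an arc enters around 0, the index never drops. So
each unit of index costs a round trip whose length is the distance from 0 after each jump. This
gives the recursions `insVisits` and `insExtra`, proved optimal in `insBound_and_outBound` for the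
lexicographic cost (blocks, surplus letters). When the budget is met exactly every block is forced,
whence `merges_unique`.

For a synchronizing word, each block takes at most one new position of an interval through 0, so m -
1 blocks leave an interval that has only been moved rigidly. If it merges, either its whole arc or
the complement of an adjacent pair shrinks, and both have index M - m - 1
(`exists_merges_of_mergesOff`). Conversely, `descent` merges one position per round and meets the
bound. With K = M - m the total is m(2K - m) blocks, and the final `outer` can be dropped, which
explains the -1 in the switch count. -/

namespace SwitchCount

/-! ### Lifted dynamics on the cycle and winding parity -/

/-- The action of the block `x ^ (i + 1) * y ^ (k + 1)` on lifted positions, where position `0` is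
the state that the letter `x` sends to the last state. -/
def step (m M : ℤ) (o : ℕ × ℕ) (p : ℤ) : ℤ :=
  -- If i = 0, the first `outer` is what leaves the last state. The fictitious position m - 1 stands
  -- for that state, since -1 - (m - 1) = -m.
  let q := if o.1 = 0 then (if M ∣ p then -p + (m - 1) else -p)
    else if o.1 % 2 = 1 then (if M ∣ p then p - m else p)
    else (if M ∣ p then -p + m else -p)
  if o.2 % 2 = 0 then -1 - q else q

/-- The action of a sequence of blocks on lifted positions. -/
def runSteps (m M : ℤ) (l : List (ℕ × ℕ)) (p : ℤ) : ℤ := l.foldl (fun p o => step m M o p) p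

/-- The number of letters by which the blocks exceed the shortest block. -/
def extra (l : List (ℕ × ℕ)) : ℕ := (l.map fun o => o.1 + o.2).sum

/-- Two lifted positions are merged, with an even winding number. -/
def Merges (m M : ℤ) (l : List (ℕ × ℕ)) (p q : ℤ) : Prop :=
  2 * M ∣ runSteps m M l p - runSteps m M l q

@[simp] theorem extra_nil : extra [] = 0 := rfl

@[simp] theorem extra_cons (o : ℕ × ℕ) (l : List (ℕ × ℕ)) :
    extra (o :: l) = o.1 + o.2 + extra l := by simp [extra]

@[simp] theorem extra_append (l l' : List (ℕ × ℕ)) : extra (l ++ l') = extra l + extra l' := by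
  simp [extra]

theorem runSteps_cons (m M : ℤ) (o : ℕ × ℕ) (l : List (ℕ × ℕ)) (p : ℤ) :
    runSteps m M (o :: l) p = runSteps m M l (step m M o p) := rfl

theorem runSteps_append (m M : ℤ) (l l' : List (ℕ × ℕ)) (p : ℤ) :
    runSteps m M (l ++ l') p = runSteps m M l' (runSteps m M l p) := by
  simp [runSteps]

variable {m M : ℤ}

/-- The sign is the orientation of the block, given by the parity of its length; the jump at
multiples of M is chosen equivariantly. -/
theorem step_add (o : ℕ × ℕ) :
    (∀ p, step m M o (p + M) = step m M o p + M) ∨ (∀ p, step m M o (p + M) = step m M o p - M) := by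
  by_cases h : (o.1 % 2 = 1 ↔ o.2 % 2 = 1)
  · left
    intro p
    simp only [step, dvd_add_self_right]
    split_ifs <;> omega
  · right
    intro p
    simp only [step, dvd_add_self_right]
    split_ifs <;> omega

theorem runSteps_add (l : List (ℕ × ℕ)) :
    (∀ p, runSteps m M l (p + M) = runSteps m M l p + M) ∨
      (∀ p, runSteps m M l (p + M) = runSteps m M l p - M) := by
  induction l with
  | nil => left; intro p; rfl
  | cons o l ih =>
    have ih' : (∀ p, runSteps m M l (p - M) = runSteps m M l p - M) ∨
        (∀ p, runSteps m M l (p - M) = runSteps m M l p + M) := by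
      refine ih.imp (fun h p => ?_) (fun h p => ?_) <;>
      · have := h (p - M)
        rw [sub_add_cancel] at this
        omega
    simp only [runSteps_cons]
    rcases step_add (m := m) (M := M) o with h | h <;> simp only [h]
    · exact ih.imp (fun h p => h _) (fun h p => h _)
    · exact ih'.symm.imp (fun h p => h _) (fun h p => h _)

theorem Merges.symm {l : List (ℕ × ℕ)} {p q : ℤ} (h : Merges m M l p q) : Merges m M l q p := by
  unfold Merges at *
  rw [← dvd_neg, neg_sub]
  exact h

theorem merges_add {l : List (ℕ × ℕ)} {p q : ℤ} :
    Merges m M l (p + M) (q + M) ↔ Merges m M l p q := by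
  unfold Merges
  rcases runSteps_add (m := m) (M := M) l with h | h <;> simp only [h]
  · rw [add_sub_add_right_eq_sub]
  · rw [sub_sub_sub_cancel_right]

/-- The images always differ by ±M, an odd multiple of M: a full turn never shrinks. -/
theorem not_merges_add (hM : 0 < M) (l : List (ℕ × ℕ)) (p q : ℤ) (h : q = p + M) :
    ¬ Merges m M l p q := by
  subst h
  unfold Merges
  rintro ⟨c, hc⟩
  rcases runSteps_add (m := m) (M := M) l with h | h <;> rw [h] at hc
  · have : M * (2 * c + 1) = 0 := by linarith
    rcases mul_eq_zero.1 this with h | h <;> omega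
  · have : M * (2 * c - 1) = 0 := by linarith
    rcases mul_eq_zero.1 this with h | h <;> omega

theorem step_of_not_dvd {p : ℤ} (h : ¬ M ∣ p) (o : ℕ × ℕ) :
    step m M o p = if o.2 % 2 = 0 then (if o.1 % 2 = 0 then p - 1 else -p - 1)
      else (if o.1 % 2 = 0 then -p else p) := by
  simp only [step, h, if_false]
  split_ifs <;> omega

theorem step_zero (o : ℕ × ℕ) :
    step m M o 0 = if o.2 % 2 = 0 then
        (if o.1 = 0 then -m else if o.1 % 2 = 1 then m - 1 else -m - 1)
      else (if o.1 = 0 then m - 1 else if o.1 % 2 = 1 then -m else m) := by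
  simp only [step, dvd_zero, if_true]
  split_ifs <;> omega

theorem not_dvd_of_pos {p : ℤ} (h : 0 < p) (h' : p < M) : ¬ M ∣ p :=
  fun h'' => absurd (Int.le_of_dvd h h'') (not_le.2 h')

theorem not_dvd_of_neg {p : ℤ} (h : p < 0) (h' : -M < p) : ¬ M ∣ p := by
  rw [← dvd_neg]
  exact not_dvd_of_pos (by omega) (by omega)

/-! ### Cost recursions and the lower bound for one pair -/

/-- The number of blocks needed from a pair of distance `m + k` around the position `0`, when it
is at an end. -/
def insVisits (m M : ℤ) : ℕ → ℤ
  | 0 => 1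
  -- One round trip: two blocks for the exit and the entry, the last minimum for the way back to 0
  -- after the exit, the first one for the way to 0 after the entry.
  | k + 1 => insVisits m M k + 2 + min (k : ℤ) (m - 1) + min (m - 1) (M - m - 2 - k)

/-- The excess needed by the sequences of `insVisits m M k` blocks. -/
def insExtra (m M : ℤ) : ℕ → ℤ
  | 0 => 1
  -- One surplus letter lowers the index. The others choose the orientation that makes the way
  -- shorter after the entry and after the exit.
  | k + 1 => insExtra m M k + 1 + (if m ≤ k then 1 else 0) + (if M - m - 1 - k < m then 1 else 0)

/-- The number of blocks needed from a pair of distance `k + 1` not around the position `0`, when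
it is at an end. -/
def outVisits (m M : ℤ) (k : ℕ) : ℤ := insVisits m M k + 1 + min (k : ℤ) (m - 1)

/-- The excess needed by the sequences of `outVisits m M k` blocks. -/
def outExtra (m M : ℤ) (k : ℕ) : ℤ := insExtra m M k + if m ≤ k then 1 else 0

/-- The cost `(v, e)` is at most that of `l`, lexicographically. -/
def CostLe (v e : ℤ) (l : List (ℕ × ℕ)) : Prop :=
  v < l.length ∨ v = l.length ∧ e ≤ extra l

theorem one_le_insVisits (hm : 1 ≤ m) : ∀ k : ℕ, (k : ℤ) < M - m → 1 ≤ insVisits m M k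
  | 0, _ => le_rfl
  | k + 1, h => by
    have := one_le_insVisits hm k (by omega)
    simp only [insVisits]
    omega

theorem merges_cons {o : ℕ × ℕ} {t : List (ℕ × ℕ)} {p q : ℤ} :
    Merges m M (o :: t) p q ↔ Merges m M t (step m M o p) (step m M o q) := Iff.rfl

/-- Brings the image of a pair into normal form: pairs are unordered and count up to a common
translation by M. -/
theorem Merges.move {l : List (ℕ × ℕ)} {p q p' q' : ℤ} (H : Merges m M l p q)
    (h : p' = p ∧ q' = q ∨ p' = q ∧ q' = p ∨ p' = p + M ∧ q' = q + M ∨ p' = q + M ∧ q' = p + M) :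
    Merges m M l p' q' := by
  rcases h with ⟨rfl, rfl⟩ | ⟨rfl, rfl⟩ | ⟨rfl, rfl⟩ | ⟨rfl, rfl⟩
  · exact H
  · exact H.symm
  · exact merges_add.2 H
  · exact merges_add.2 H.symm

/-- With no end at 0 the arc moves rigidly, so only the parities of the exponents matter. -/
theorem ins_move {o : ℕ × ℕ} {t : List (ℕ × ℕ)} {α β : ℤ} (hα : 1 ≤ α) (hβ : 1 ≤ β)
    (h : α + β < M) (H : Merges m M (o :: t) (-α) β) :
    (o.2 % 2 = 0 ∧ o.1 % 2 = 0 ∧ Merges m M t (-(α + 1)) (β - 1)) ∨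
    (o.2 % 2 = 0 ∧ o.1 % 2 = 1 ∧ Merges m M t (-(β + 1)) (α - 1)) ∨
    (o.2 % 2 = 1 ∧ o.1 % 2 = 0 ∧ Merges m M t (-β) α) ∨
    (o.2 % 2 = 1 ∧ o.1 % 2 = 1 ∧ Merges m M t (-α) β) := by
  rw [merges_cons, step_of_not_dvd (not_dvd_of_neg (M := M) (p := -α) (by omega) (by omega)),
    step_of_not_dvd (not_dvd_of_pos (M := M) (p := β) (by omega) (by omega))] at H
  rcases Nat.mod_two_eq_zero_or_one o.1 with h1 | h1 <;>
  rcases Nat.mod_two_eq_zero_or_one o.2 with h2 | h2 <;>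
  simp only [h1, h2, if_true, if_false, one_ne_zero, zero_ne_one, false_and, true_and, and_false,
    false_or, or_false] at H ⊢ <;> exact H.move (by omega)

theorem out_move {o : ℕ × ℕ} {t : List (ℕ × ℕ)} {u w : ℤ} (hu : 1 ≤ u) (hw : 1 ≤ w)
    (h : u + w < M) (H : Merges m M (o :: t) u (M - w)) :
    (o.2 % 2 = 0 ∧ o.1 % 2 = 0 ∧ Merges m M t (u - 1) (M - (w + 1))) ∨
    (o.2 % 2 = 0 ∧ o.1 % 2 = 1 ∧ Merges m M t (w - 1) (M - (u + 1))) ∨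
    (o.2 % 2 = 1 ∧ o.1 % 2 = 0 ∧ Merges m M t w (M - u)) ∨
    (o.2 % 2 = 1 ∧ o.1 % 2 = 1 ∧ Merges m M t u (M - w)) := by
  rw [merges_cons, step_of_not_dvd (not_dvd_of_pos (M := M) (p := u) (by omega) (by omega)),
    step_of_not_dvd (not_dvd_of_pos (M := M) (p := M - w) (by omega) (by omega))] at H
  rcases Nat.mod_two_eq_zero_or_one o.1 with h1 | h1 <;>
  rcases Nat.mod_two_eq_zero_or_one o.2 with h2 | h2 <;>
  simp only [h1, h2, if_true, if_false, one_ne_zero, zero_ne_one, false_and, true_and, and_false,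
    false_or, or_false] at H ⊢ <;> exact H.move (by omega)

/-- A pair around the position `0` with an end at `0` is left behind by each kind of block; here
`e = m + k` is the distance of the pair. -/
theorem ins_exit {o : ℕ × ℕ} {t : List (ℕ × ℕ)} {k : ℤ} (hm : 1 ≤ m) (hk : 0 ≤ k) (hkM : m + k < M)
    (H : Merges m M (o :: t) (-(m + k)) 0) :
    (o.2 % 2 = 0 ∧ o.1 = 0 ∧ Merges m M t (M - m - 1 - k) (M - m)) ∨
    (o.2 % 2 = 0 ∧ o.1 ≠ 0 ∧ o.1 % 2 = 0 ∧ Merges m M t (M - m - 1 - k) (M - (m + 1))) ∨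
    (o.2 % 2 = 1 ∧ o.1 = 0 ∧ Merges m M t (m - 1) (M - (M - m - k))) ∨
    (o.2 % 2 = 1 ∧ o.1 ≠ 0 ∧ o.1 % 2 = 0 ∧ Merges m M t m (M - (M - m - k))) ∨
    (o.2 % 2 = 0 ∧ o.1 % 2 = 1 ∧ Merges m M t (m - 1) (M - (M - m - k + 1))) ∨
    (o.2 % 2 = 1 ∧ o.1 % 2 = 1 ∧ Merges m M t (M - m - k) (M - m)) := by
  rw [merges_cons, step_zero,
    step_of_not_dvd (not_dvd_of_neg (M := M) (p := -(m + k)) (by omega) (by omega))] at H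
  rcases Nat.mod_two_eq_zero_or_one o.2 with h2 | h2 <;>
  rcases Nat.mod_two_eq_zero_or_one o.1 with h1 | h1 <;>
  rcases eq_or_ne o.1 0 with h0 | h0 <;>
  first
  | omega
  | simp only [h0, h1, h2, if_true, if_false, one_ne_zero, zero_ne_one, false_and, true_and,
      and_false, false_or, or_false, Nat.zero_mod, ne_eq, not_false_eq_true, not_true_eq_false]
      at H ⊢
    exact H.move (by omega)

/-- A pair not around the position `0` with its first end at `0` gets around `0`; here
`k + 1` is the distance of the pair. -/
theorem out_enter {o : ℕ × ℕ} {t : List (ℕ × ℕ)} {k : ℤ} (hm : 1 ≤ m) (hk : 0 ≤ k)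
    (hkM : m + k < M) (H : Merges m M (o :: t) 0 (k + 1)) :
    (o.2 % 2 = 0 ∧ o.1 = 0 ∧ Merges m M t (-m) k) ∨
    (o.2 % 2 = 0 ∧ o.1 ≠ 0 ∧ o.1 % 2 = 0 ∧ Merges m M t (-(m + 1)) k) ∨
    (o.2 % 2 = 1 ∧ o.1 = 0 ∧ Merges m M t (-(k + 1)) (m - 1)) ∨
    (o.2 % 2 = 1 ∧ o.1 ≠ 0 ∧ o.1 % 2 = 0 ∧ Merges m M t (-(k + 1)) m) ∨
    (o.2 % 2 = 0 ∧ o.1 % 2 = 1 ∧ Merges m M t (-(k + 2)) (m - 1)) ∨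
    (o.2 % 2 = 1 ∧ o.1 % 2 = 1 ∧ Merges m M t (-m) (k + 1)) := by
  rw [merges_cons, step_zero,
    step_of_not_dvd (not_dvd_of_pos (M := M) (p := k + 1) (by omega) (by omega))] at H
  rcases Nat.mod_two_eq_zero_or_one o.2 with h2 | h2 <;>
  rcases Nat.mod_two_eq_zero_or_one o.1 with h1 | h1 <;>
  rcases eq_or_ne o.1 0 with h0 | h0 <;>
  first
  | omega
  | simp only [h0, h1, h2, if_true, if_false, one_ne_zero, zero_ne_one, false_and, true_and,
      and_false, false_or, or_false, Nat.zero_mod, ne_eq, not_false_eq_true, not_true_eq_false]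
      at H ⊢
    exact H.move (by omega)

/-- The cost bound for pairs around the position `0`. -/
def InsBound (m M : ℤ) (l : List (ℕ × ℕ)) : Prop :=
  ∀ (k : ℕ) (α β : ℤ), 1 ≤ α → 0 ≤ β → α + β = m + k → m + k < M → Merges m M l (-α) β →
    CostLe (insVisits m M k + min α β) (insExtra m M k + if α < β then 1 else 0) l

/-- The cost bound for pairs not around the position `0`. -/
def OutBound (m M : ℤ) (l : List (ℕ × ℕ)) : Prop :=
  ∀ (k : ℕ) (u w : ℤ), 0 ≤ u → 1 ≤ w → u + w = M - 1 - k → m + k < M → Merges m M l u (M - w) →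
    CostLe (outVisits m M k + min u w) (outExtra m M k + if w < u then 1 else 0) l

/-- A rigid move brings an end at most one step nearer to 0, and turning costs a letter. At an end,
the exits with i > 0 gain one index and are matched by the recursion; those with i = 0 keep the
index and waste blocks. -/
theorem insBound_cons {o : ℕ × ℕ} {t : List (ℕ × ℕ)} (hm : 1 ≤ m) (hM : 2 * m ≤ M)
    (hi : InsBound m M t) (ho : OutBound m M t) : InsBound m M (o :: t) := by
  intro k α β hα hβ h hk H
  rcases hβ.lt_or_eq with hβ | rfl
  · simp only [CostLe, List.length_cons, extra_cons, Nat.cast_add, Nat.cast_one]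
    rcases ins_move hα hβ (by omega) H with ⟨h2, h1, H⟩ | ⟨h2, h1, H⟩ | ⟨h2, h1, H⟩ | ⟨h2, h1, H⟩
    · have := hi k _ _ (by omega) (by omega) (by omega) hk H
      unfold CostLe at this; omega
    · have := hi k _ _ (by omega) (by omega) (by omega) hk H
      unfold CostLe at this; omega
    · have := hi k _ _ (by omega) (by omega) (by omega) hk H
      unfold CostLe at this; omega
    · have := hi k _ _ (by omega) (by omega) (by omega) hk H
      unfold CostLe at this; omega
  · obtain rfl : α = m + k := by omega
    simp only [CostLe, List.length_cons, extra_cons, Nat.cast_add, Nat.cast_one]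
    have hn := ins_exit hm (by omega) hk H
    rcases hn with ⟨h2, h1, H⟩ | ⟨h2, h0, h1, H⟩ | ⟨h2, h1, H⟩ | ⟨h2, h0, h1, H⟩ | ⟨h2, h1, H⟩ |
      ⟨h2, h1, H⟩
    · have := ho k _ _ (by omega) (by omega) (by omega) hk H
      unfold CostLe outVisits at this; omega
    · rcases k with _ | k
      · simp only [insVisits, insExtra]; omega
      · have := ho k _ _ (by omega) (by omega) (by omega) (by omega) H
        simp only [CostLe, outVisits, outExtra, insVisits, insExtra] at this ⊢; omega
    · have := ho k _ _ (by omega) (by omega) (by omega) hk H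
      unfold CostLe outVisits at this; omega
    all_goals
      rcases k with _ | k
      · simp only [insVisits, insExtra]; omega
      · have := ho k _ _ (by omega) (by omega) (by omega) (by omega) H
        simp only [CostLe, outVisits, outExtra, insVisits, insExtra] at this ⊢; omega

theorem outBound_cons {o : ℕ × ℕ} {t : List (ℕ × ℕ)} (hm : 1 ≤ m) (hM : 2 * m ≤ M)
    (hi : InsBound m M t) (ho : OutBound m M t) : OutBound m M (o :: t) := by
  intro k u w hu hw h hk H
  simp only [CostLe, List.length_cons, extra_cons, Nat.cast_add, Nat.cast_one]
  rcases hu.lt_or_eq with hu | rfl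
  · rcases out_move hu hw (by omega) H with ⟨h2, h1, H⟩ | ⟨h2, h1, H⟩ | ⟨h2, h1, H⟩ | ⟨h2, h1, H⟩ <;>
    · have := ho k _ _ (by omega) (by omega) (by omega) hk H
      unfold CostLe at this; omega
  -- Entries with i > 0 raise the index. If the new length reaches M, the ends differ by a full turn
  -- and cannot merge.
  · have enter : ∀ {α β : ℤ}, 1 ≤ α → 0 ≤ β → α + β = m + (k + 1 : ℕ) → Merges m M t (-α) β →
        m + (k + 1 : ℕ) < M ∧ CostLe (insVisits m M (k + 1) + min α β)
          (insExtra m M (k + 1) + if α < β then 1 else 0) t := by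
      intro α β hα hβ h' H
      have : m + (k + 1 : ℕ) < M := by
        by_contra h''
        exact not_merges_add (by omega) t (-α) β (by omega) H
      exact ⟨this, hi _ _ _ hα hβ h' this H⟩
    rw [show M - w = (k : ℤ) + 1 by omega] at H
    rcases out_enter hm (by omega) hk H with ⟨h2, h1, H⟩ | ⟨h2, h0, h1, H⟩ | ⟨h2, h1, H⟩ |
      ⟨h2, h0, h1, H⟩ | ⟨h2, h1, H⟩ | ⟨h2, h1, H⟩
    · have := hi k _ _ (by omega) (by omega) (by omega) hk H
      simp only [CostLe, outVisits, outExtra] at this ⊢; omega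
    · obtain ⟨_, this⟩ := enter (by omega) (by omega) (by push_cast; ring) H
      simp only [CostLe, outVisits, outExtra, insVisits, insExtra] at this ⊢; omega
    · have := hi k _ _ (by omega) (by omega) (by omega) hk H
      simp only [CostLe, outVisits, outExtra] at this ⊢; omega
    all_goals
      obtain ⟨_, this⟩ := enter (by omega) (by omega) (by push_cast; ring) H
      simp only [CostLe, outVisits, outExtra, insVisits, insExtra] at this ⊢; omega

theorem insBound_and_outBound (hm : 1 ≤ m) (hM : 2 * m ≤ M) (l : List (ℕ × ℕ)) :
    InsBound m M l ∧ OutBound m M l := by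
  induction l with
  | nil =>
    have key : ∀ p q : ℤ, p < q → q < p + M → ¬ Merges m M [] p q := by
      intro p q h1 h2 H
      have := Int.le_of_dvd (show 0 < q - p by omega) H.symm
      omega
    exact ⟨fun k α β hα hβ h hk H => absurd H (key _ _ (by omega) (by omega)),
      fun k u w hu hw h hk H => absurd H (key _ _ (by omega) (by omega))⟩
  | cons o t ih =>
    exact ⟨insBound_cons hm hM ih.1 ih.2, outBound_cons hm hM ih.1 ih.2⟩

/-! ### Rigidity of cheapest sequences for one pair -/

/-- Any other block fails to bring the near end closer to 0 or spends a surplus letter, and the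
exact budget allows neither. -/
theorem ins_forced_move (hm : 1 ≤ m) (hM : 2 * m ≤ M) {o : ℕ × ℕ} {t : List (ℕ × ℕ)} {k : ℕ}
    {α β : ℤ} (hβ : 1 ≤ β) (hαβ : β < α) (h : α + β = m + k) (hk : m + k < M)
    (H : Merges m M (o :: t) (-α) β) (hl : ((o :: t).length : ℤ) = insVisits m M k + β)
    (he : (extra (o :: t) : ℤ) = insExtra m M k) :
    o = (0, 0) ∧ Merges m M t (-(α + 1)) (β - 1) := by
  obtain ⟨hi, -⟩ := insBound_and_outBound hm hM t
  obtain ⟨i, j⟩ := o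
  simp only [List.length_cons, extra_cons, Nat.cast_add, Nat.cast_one] at hl he
  rcases ins_move (by omega) hβ (by omega) H with ⟨h2, h1, H⟩ | ⟨h2, h1, H⟩ | ⟨h2, h1, H⟩ |
    ⟨h2, h1, H⟩ <;>
  · have := hi k _ _ (by omega) (by omega) (by omega) hk H
    unfold CostLe at this
    simp only [Prod.mk.injEq] at h1 h2 ⊢
    first
    | exact ⟨by omega, H⟩
    | omega

theorem out_forced_move (hm : 1 ≤ m) (hM : 2 * m ≤ M) {o : ℕ × ℕ} {t : List (ℕ × ℕ)} {k : ℕ}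
    {u w : ℤ} (hu : 1 ≤ u) (huw : u < w) (h : u + w = M - 1 - k) (hk : m + k < M)
    (H : Merges m M (o :: t) u (M - w)) (hl : ((o :: t).length : ℤ) = outVisits m M k + u)
    (he : (extra (o :: t) : ℤ) = outExtra m M k) :
    o = (0, 0) ∧ Merges m M t (u - 1) (M - (w + 1)) := by
  obtain ⟨-, ho⟩ := insBound_and_outBound hm hM t
  obtain ⟨i, j⟩ := o
  simp only [List.length_cons, extra_cons, Nat.cast_add, Nat.cast_one] at hl he
  rcases out_move hu (by omega) (by omega) H with ⟨h2, h1, H⟩ | ⟨h2, h1, H⟩ | ⟨h2, h1, H⟩ |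
    ⟨h2, h1, H⟩ <;>
  · have := ho k _ _ (by omega) (by omega) (by omega) hk H
    unfold CostLe at this
    simp only [Prod.mk.injEq] at h1 h2 ⊢
    first
    | exact ⟨by omega, H⟩
    | omega

/-- The block (1, 0) leaves the arc m - 1 steps from 0, and (2, 0) leaves it M - m - 2 - k steps
away at one more letter; the threshold M - 2m decides which is cheaper. -/
theorem ins_forced_exit (hm : 1 ≤ m) (hM : 2 * m ≤ M) {o : ℕ × ℕ} {t : List (ℕ × ℕ)} {k : ℕ}
    (hk : m + (k + 1 : ℕ) < M) (H : Merges m M (o :: t) (-(m + (k + 1 : ℕ))) 0)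
    (hl : ((o :: t).length : ℤ) = insVisits m M (k + 1))
    (he : (extra (o :: t) : ℤ) = insExtra m M (k + 1)) :
    (k < M - 2 * m ∧ o = (1, 0) ∧ Merges m M t (m - 1) (M - (M - m - k))) ∨
      (M - 2 * m ≤ k ∧ o = (2, 0) ∧ Merges m M t (M - m - 2 - k) (M - (m + 1))) := by
  obtain ⟨-, ho⟩ := insBound_and_outBound hm hM t
  obtain ⟨i, j⟩ := o
  simp only [List.length_cons, extra_cons, Nat.cast_add, Nat.cast_one, insVisits, insExtra] at hl he
  rcases ins_exit hm (by omega) hk H with ⟨h2, h1, H⟩ | ⟨h2, h0, h1, H⟩ | ⟨h2, h1, H⟩ |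
    ⟨h2, h0, h1, H⟩ | ⟨h2, h1, H⟩ | ⟨h2, h1, H⟩ <;> simp only [Prod.mk.injEq] at h1 h2 ⊢
  · have := ho (k + 1) _ _ (by omega) (by omega) (by omega) hk H
    simp only [CostLe, outVisits, insVisits] at this; omega
  · have := ho k _ _ (by omega) (by omega) (by omega) (by omega) H
    simp only [CostLe, outVisits, outExtra] at this
    exact Or.inr ⟨by omega, by omega, H.move (by omega)⟩
  · have := ho (k + 1) _ _ (by omega) (by omega) (by omega) hk H
    simp only [CostLe, outVisits, insVisits] at this; omega
  · have := ho k _ _ (by omega) (by omega) (by omega) (by omega) H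
    simp only [CostLe, outVisits, outExtra] at this; omega
  · have := ho k _ _ (by omega) (by omega) (by omega) (by omega) H
    simp only [CostLe, outVisits, outExtra] at this
    exact Or.inl ⟨by omega, by omega, H.move (by omega)⟩
  · have := ho k _ _ (by omega) (by omega) (by omega) (by omega) H
    simp only [CostLe, outVisits, outExtra] at this; omega

theorem ins_forced_exit_zero (hm : 1 ≤ m) (hM : 2 * m ≤ M) {o : ℕ × ℕ} {t : List (ℕ × ℕ)}
    (H : Merges m M (o :: t) (-m) 0) (hl : (o :: t).length = 1) (he : extra (o :: t) = 1) :
    o :: t = [(1, 0)] := by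
  obtain ⟨-, ho⟩ := insBound_and_outBound hm hM t
  obtain ⟨i, j⟩ := o
  obtain rfl : t = [] := by simpa using hl
  simp only [extra_cons, extra_nil] at he
  rw [show -m = -(m + 0) by ring] at H
  rcases ins_exit hm le_rfl (by omega) H with ⟨h2, h1, H⟩ | ⟨h2, h0, h1, H⟩ | ⟨h2, h1, H⟩ |
    ⟨h2, h0, h1, H⟩ | ⟨h2, h1, H⟩ | ⟨h2, h1, H⟩ <;> simp only at h1 h2
  all_goals first
    | omega
    | (have := ho 0 _ _ (by omega) (by omega) (by push_cast; omega) (by push_cast; omega) H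
       have h' := one_le_insVisits (M := M) hm 0 (by push_cast; omega)
       simp only [CostLe, outVisits, List.length_nil, Nat.cast_zero] at this
       omega)
    | (obtain ⟨rfl, rfl⟩ : i = 1 ∧ j = 0 := by omega
       rfl)

theorem out_forced_enter (hm : 1 ≤ m) (hM : 2 * m ≤ M) {o : ℕ × ℕ} {t : List (ℕ × ℕ)} {k : ℕ}
    (hk : m + k < M) (H : Merges m M (o :: t) 0 (k + 1))
    (hl : ((o :: t).length : ℤ) = outVisits m M k)
    (he : (extra (o :: t) : ℤ) = outExtra m M k) :
    (k < m ∧ o = (0, 0) ∧ Merges m M t (-m) k) ∨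
      (m ≤ k ∧ o = (0, 1) ∧ Merges m M t (-(k + 1)) (m - 1)) := by
  obtain ⟨hi, -⟩ := insBound_and_outBound hm hM t
  obtain ⟨i, j⟩ := o
  simp only [List.length_cons, extra_cons, Nat.cast_add, Nat.cast_one, outVisits, outExtra] at hl he
  have enter : ∀ {α β : ℤ}, 1 ≤ α → 0 ≤ β → α + β = m + (k + 1 : ℕ) → ¬ Merges m M t (-α) β := by
    intro α β hα hβ h' H
    have h'' : m + (k + 1 : ℕ) < M := by
      by_contra h''
      exact not_merges_add (by omega) t (-α) β (by omega) H
    have := hi _ _ _ hα hβ h' h'' H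
    simp only [CostLe, insVisits] at this
    omega
  rcases out_enter hm (by omega) hk H with ⟨h2, h1, H⟩ | ⟨h2, h0, h1, H⟩ | ⟨h2, h1, H⟩ |
    ⟨h2, h0, h1, H⟩ | ⟨h2, h1, H⟩ | ⟨h2, h1, H⟩ <;> simp only [Prod.mk.injEq] at h1 h2 ⊢
  · have := hi k _ _ (by omega) (by omega) (by omega) hk H
    simp only [CostLe] at this
    exact Or.inl ⟨by omega, by omega, H⟩
  · exact absurd H (enter (by omega) (by omega) (by push_cast; ring))
  · have := hi k _ _ (by omega) (by omega) (by omega) hk H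
    simp only [CostLe] at this
    exact Or.inr ⟨by omega, by omega, H⟩
  all_goals exact absurd H (enter (by omega) (by omega) (by push_cast; ring))

/-- The cheapest sequence of blocks merging a pair is unique, if the pair is nearer to the position
`0` in the direction of motion. -/
theorem merges_unique (hm : 1 ≤ m) (hM : 2 * m ≤ M) (l l' : List (ℕ × ℕ))
    (hl : l'.length = l.length) (he : extra l' = extra l) :
    (∀ (k : ℕ) (α β : ℤ), 0 ≤ β → β < α → α + β = m + k → m + k < M → Merges m M l (-α) β →
      Merges m M l' (-α) β → (l.length : ℤ) = insVisits m M k + β →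
      (extra l : ℤ) = insExtra m M k → l' = l) ∧
    (∀ (k : ℕ) (u w : ℤ), 0 ≤ u → u < w → u + w = M - 1 - k → m + k < M → Merges m M l u (M - w) →
      Merges m M l' u (M - w) → (l.length : ℤ) = outVisits m M k + u →
      (extra l : ℤ) = outExtra m M k → l' = l) := by
  induction l generalizing l' with
  | nil =>
    have := List.length_eq_zero_iff.1 hl
    exact ⟨fun _ _ _ _ _ _ _ _ _ _ _ => this, fun _ _ _ _ _ _ _ _ _ _ _ => this⟩
  | cons o t ih =>
    rcases l' with _ | ⟨o', t'⟩
    · simp at hl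
    have hlt : t'.length = t.length := by simpa using hl
    constructor
    · intro k α β hβ hαβ h hk H H' hL hE
      have hL' : ((o' :: t').length : ℤ) = insVisits m M k + β := by rw [hl, hL]
      have hE' : (extra (o' :: t') : ℤ) = insExtra m M k := by rw [he, hE]
      rcases hβ.lt_or_eq with hβ | rfl
      · obtain ⟨rfl, G⟩ := ins_forced_move hm hM hβ hαβ h hk H hL hE
        obtain ⟨rfl, G'⟩ := ins_forced_move hm hM hβ hαβ h hk H' hL' hE'
        simp only [extra_cons, List.length_cons] at he hE hL
        rw [(ih t' hlt (by omega)).1 k _ _ (by omega) (by omega) (by omega) hk G G' (by omega)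
          (by omega)]
      · obtain rfl : α = m + k := by omega
        rw [add_zero] at hL hL'
        rcases k with _ | k
        · simp only [Nat.cast_zero, add_zero, insVisits, insExtra] at *
          rw [ins_forced_exit_zero hm hM H (by omega) (by omega),
            ins_forced_exit_zero hm hM H' (by omega) (by omega)]
        · rcases ins_forced_exit hm hM hk H hL hE with ⟨h1, rfl, G⟩ | ⟨h1, rfl, G⟩ <;>
          rcases ins_forced_exit hm hM hk H' hL' hE' with ⟨h1', rfl, G'⟩ | ⟨h1', rfl, G'⟩ <;>
          first
          | omega
          | simp only [extra_cons, List.length_cons, insVisits, insExtra] at he hE hL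
            rw [(ih t' hlt (by omega)).2 k _ _ (by omega) (by omega) (by omega) (by omega) G G'
              (by simp only [outVisits]; omega) (by simp only [outExtra]; omega)]
    · intro k u w hu huw h hk H H' hL hE
      have hL' : ((o' :: t').length : ℤ) = outVisits m M k + u := by rw [hl, hL]
      have hE' : (extra (o' :: t') : ℤ) = outExtra m M k := by rw [he, hE]
      rcases hu.lt_or_eq with hu | rfl
      · obtain ⟨rfl, G⟩ := out_forced_move hm hM hu huw h hk H hL hE
        obtain ⟨rfl, G'⟩ := out_forced_move hm hM hu huw h hk H' hL' hE'
        simp only [extra_cons, List.length_cons] at he hE hL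
        rw [(ih t' hlt (by omega)).2 k _ _ (by omega) (by omega) (by omega) hk G G' (by omega)
          (by omega)]
      · rw [add_zero] at hL hL'
        rw [show M - w = (k : ℤ) + 1 by omega] at H H'
        rcases out_forced_enter hm hM hk H hL hE with ⟨h1, rfl, G⟩ | ⟨h1, rfl, G⟩ <;>
        rcases out_forced_enter hm hM hk H' hL' hE' with ⟨h1', rfl, G'⟩ | ⟨h1', rfl, G'⟩ <;>
        first
        | omega
        | simp only [extra_cons, List.length_cons, outVisits, outExtra] at he hE hL
          rw [(ih t' hlt (by omega)).1 k _ _ (by omega) (by omega) (by omega) (by omega) G G'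
            (by omega) (by omega)]

end SwitchCount
-- From merging all positions to merging one pair
namespace SwitchCount
variable {m M : ℤ}

/-- All lifted positions from `j` to `M - 1 - i` are merged modulo `M`. -/
def MergesOff (m M : ℤ) (l : List (ℕ × ℕ)) (i j : ℤ) : Prop :=
  ∀ p q, j ≤ p → p ≤ M - 1 - i → j ≤ q → q ≤ M - 1 - i →
    M ∣ runSteps m M l p - runSteps m M l q

theorem dvd_runSteps_add_sub (l : List (ℕ × ℕ)) (p : ℤ) :
    M ∣ runSteps m M l (p + M) - runSteps m M l p := by
  rcases runSteps_add (m := m) (M := M) l with h | h <;> rw [h]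
  · exact ⟨1, by ring⟩
  · exact ⟨-1, by ring⟩

/-- Winding parities add along the interval. If all adjacent pairs merge evenly, so do its ends; an
adjacent pair merging oddly is one whose complementary arc shrinks. -/
theorem exists_merges_of_mergesOff {l : List (ℕ × ℕ)} {i j : ℤ} (hij : i + j ≤ M - 1)
    (h : MergesOff m M l i j) :
    (∃ p, j ≤ p ∧ p + 1 ≤ M - 1 - i ∧ Merges m M l (-(M - 1 - p)) p) ∨
      Merges m M l j (M - (i + 1)) := by
  by_contra! H
  obtain ⟨H, H'⟩ := H
  have key : ∀ p, j ≤ p → p ≤ M - 1 - i → 2 * M ∣ runSteps m M l j - runSteps m M l p := by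
    intro p hp
    induction p, hp using Int.leInduction with
    | base => intro _; simp
    | succ p hp ih =>
      intro hp'
      obtain ⟨c, hc⟩ := h p (p + 1) hp (by omega) (by omega) (by omega)
      have h2 := H p hp hp'
      have h3 : runSteps m M l (p + 1) = runSteps m M l (-(M - 1 - p)) + M ∨
          runSteps m M l (p + 1) = runSteps m M l (-(M - 1 - p)) - M := by
        rw [show p + 1 = -(M - 1 - p) + M by ring]
        exact (runSteps_add l).imp (fun h => h _) (fun h => h _)
      have h4 : 2 * M ∣ runSteps m M l p - runSteps m M l (p + 1) := by
        rw [hc]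
        rcases Int.even_or_odd' c with ⟨d, rfl | rfl⟩
        · exact ⟨d, by ring⟩
        · refine absurd ?_ h2
          rcases h3 with h3 | h3
          · exact ⟨-d - 1, by linarith⟩
          · exact ⟨-d, by linarith⟩
      have := dvd_add (ih (by omega)) h4
      rwa [sub_add_sub_cancel] at this
  exact H' (by have := key (M - 1 - i) (by omega) le_rfl; rwa [sub_sub, add_comm 1 i] at this)

theorem MergesOff.cons {o : ℕ × ℕ} {t : List (ℕ × ℕ)} {i j : ℤ} (hi : 0 ≤ i) (hj : 1 ≤ j)
    (h : MergesOff m M (o :: t) i j) :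
    (o.2 % 2 = 0 ∧ o.1 % 2 = 0 ∧ MergesOff m M t (i + 1) (j - 1)) ∨
    (o.2 % 2 = 0 ∧ o.1 % 2 = 1 ∧ MergesOff m M t j i) ∨
    (o.2 % 2 = 1 ∧ o.1 % 2 = 0 ∧ MergesOff m M t (j - 1) (i + 1)) ∨
    (o.2 % 2 = 1 ∧ o.1 % 2 = 1 ∧ MergesOff m M t i j) := by
  have hs : ∀ p, j ≤ p → p ≤ M - 1 - i → ¬ M ∣ p := fun p h1 h2 =>
    not_dvd_of_pos (by omega) (by omega)
  unfold MergesOff at h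
  simp only [runSteps_cons] at h
  rcases Nat.mod_two_eq_zero_or_one o.1 with h1 | h1 <;>
  rcases Nat.mod_two_eq_zero_or_one o.2 with h2 | h2 <;>
  simp only [h1, h2, one_ne_zero, zero_ne_one, false_and, true_and, false_or, or_false] <;>
  intro p q hp hp' hq hq'
  · have := h (p + 1) (q + 1) (by omega) (by omega) (by omega) (by omega)
    rw [step_of_not_dvd (hs _ (by omega) (by omega)),
      step_of_not_dvd (hs _ (by omega) (by omega))] at this
    simpa [h1, h2] using this
  · have := h (M - p) (M - q) (by omega) (by omega) (by omega) (by omega)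
    rw [step_of_not_dvd (hs _ (by omega) (by omega)),
      step_of_not_dvd (hs _ (by omega) (by omega))] at this
    simp only [h1, h2, if_true, if_false, one_ne_zero, neg_sub] at this
    have hp := dvd_runSteps_add_sub (m := m) (M := M) t (p - M)
    have hq := dvd_runSteps_add_sub (m := m) (M := M) t (q - M)
    rw [sub_add_cancel] at hp hq
    have := dvd_sub (dvd_add hp this) hq
    rwa [sub_add_sub_cancel, sub_sub_sub_cancel_right] at this
  · have := h (M - 1 - p) (M - 1 - q) (by omega) (by omega) (by omega) (by omega)
    rw [step_of_not_dvd (hs _ (by omega) (by omega)),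
      step_of_not_dvd (hs _ (by omega) (by omega))] at this
    simp only [h1, h2, if_true, if_false, one_ne_zero] at this
    rw [show -(M - 1 - p) - 1 = p - M by ring, show -(M - 1 - q) - 1 = q - M by ring] at this
    have hp := dvd_runSteps_add_sub (m := m) (M := M) t (p - M)
    have hq := dvd_runSteps_add_sub (m := m) (M := M) t (q - M)
    rw [sub_add_cancel] at hp hq
    have := dvd_sub (dvd_add hp this) hq
    rwa [sub_add_sub_cancel, sub_sub_sub_cancel_right] at this
  · have := h p q (by omega) (by omega) (by omega) (by omega)
    rw [step_of_not_dvd (hs _ (by omega) (by omega)),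
      step_of_not_dvd (hs _ (by omega) (by omega))] at this
    simpa [h1, h2] using this

theorem MergesOff.mono {l : List (ℕ × ℕ)} {i j j' : ℤ} (h : MergesOff m M l i j) (hj : j ≤ j') :
    MergesOff m M l i j' :=
  fun p q hp hp' hq hq' => h p q (hj.trans hp) hp' (hj.trans hq) hq'

/-- While i + j < m - 1, a block discards at most one more position. At i + j = m - 1, both arcs
offered by `exists_merges_of_mergesOff` have index K. -/
theorem costLe_of_mergesOff (hm : 1 ≤ m) (hM : 2 * m ≤ M) {K : ℕ}
    (hK : m + K = M - 1) (l : List (ℕ × ℕ)) (i j : ℤ) (hi : 0 ≤ i) (hj : 0 ≤ j)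
    (hij : i + j ≤ m - 1) (h : MergesOff m M l i j) :
    CostLe (m - 1 - (i + j) + insVisits m M K) (insExtra m M K) l := by
  induction l generalizing i j with
  | nil =>
    exfalso
    have := Int.le_of_dvd (by simp [runSteps]) (h (j + 1) j (by omega) (by omega) (by omega) (by omega))
    simp only [runSteps, List.foldl_nil] at this
    omega
  | cons o t ih =>
    rcases hij.lt_or_eq with hij | hij
    -- Position 0, about to jump, is dropped from the interval if present; this is the only loss.
    · have hh := (h.mono (le_max_left j 1)).cons hi (le_max_right j 1)
      simp only [CostLe, List.length_cons, extra_cons, Nat.cast_add, Nat.cast_one]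
      rcases hh with ⟨_, _, h⟩ | ⟨_, _, h⟩ | ⟨_, _, h⟩ | ⟨_, _, h⟩ <;>
      · have := ih _ _ (by omega) (by omega) (by omega) h
        unfold CostLe at this
        omega
    · obtain ⟨hI, hO⟩ := insBound_and_outBound hm hM (o :: t)
      rcases exists_merges_of_mergesOff (by omega) h with ⟨p, hp, hp', H⟩ | H
      · have := hI K _ _ (by omega) (by omega) (by omega) (by omega) H
        unfold CostLe at this ⊢
        omega
      · have := hO K _ _ (by omega) (by omega) (by omega) (by omega) H
        unfold CostLe outVisits at this
        unfold CostLe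
        omega

theorem mergesOff_unique (hm : 1 ≤ m) (hM : 2 * m ≤ M) {K : ℕ}
    (hK : m + K = M - 1) (l l' : List (ℕ × ℕ)) (hl : l'.length = l.length)
    (he : extra l' = extra l) (i : ℤ) (hi : 0 ≤ i) (him : i ≤ m - 1)
    (h : MergesOff m M l i 0) (h' : MergesOff m M l' i 0)
    (hL : (l.length : ℤ) = m - 1 - i + insVisits m M K) (hE : (extra l : ℤ) = insExtra m M K) :
    l' = l := by
  induction l generalizing i l' with
  | nil => exact List.length_eq_zero_iff.1 hl
  | cons o t ih =>
    rcases him.lt_or_eq with him | him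
    · have key : ∀ (o : ℕ × ℕ) (t : List (ℕ × ℕ)), MergesOff m M (o :: t) i 0 →
          ((o :: t).length : ℤ) = m - 1 - i + insVisits m M K →
          (extra (o :: t) : ℤ) = insExtra m M K → o = (0, 0) ∧ MergesOff m M t (i + 1) 0 := by
        intro ⟨a, b⟩ t h hL hE
        simp only [List.length_cons, extra_cons, Nat.cast_add, Nat.cast_one] at hL hE
        rcases (h.mono zero_le_one).cons hi le_rfl with ⟨h2, h1, h⟩ | ⟨h2, h1, h⟩ | ⟨h2, h1, h⟩ |
          ⟨h2, h1, h⟩ <;>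
        · have := costLe_of_mergesOff hm hM hK t _ _ (by omega) (by omega) (by omega) h
          unfold CostLe at this
          simp only [Prod.mk.injEq] at h1 h2 ⊢
          first
          | exact ⟨by omega, h⟩
          | omega
      rcases l' with _ | ⟨o', t'⟩
      · simp at hl
      obtain ⟨rfl, g⟩ := key o t h hL hE
      obtain ⟨rfl, g'⟩ := key o' t' h' (by rw [hl, hL]) (by rw [he, hE])
      simp only [extra_cons, List.length_cons] at he hl hE hL
      rw [ih t' (by omega) (by omega) (i + 1) (by omega) (by omega) g g' (by omega) (by omega)]
    -- The remaining blocks are too few for an arc avoiding 0, or for one around 0 without an end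
    -- there; only p = 0 is left.
    · have key : ∀ l : List (ℕ × ℕ), MergesOff m M l i 0 →
          (l.length : ℤ) = m - 1 - i + insVisits m M K → Merges m M l (-(M - 1)) 0 := by
        intro l h hL
        obtain ⟨hI, hO⟩ := insBound_and_outBound hm hM l
        rcases exists_merges_of_mergesOff (by omega) h with ⟨p, hp, hp', H⟩ | H
        · have := hI K _ _ (by omega) (by omega) (by omega) (by omega) H
          unfold CostLe at this
          obtain rfl : p = 0 := by omega
          simpa using H
        · have := hO K _ _ (by omega) (by omega) (by omega) (by omega) H
          unfold CostLe outVisits at this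
          omega
      exact (merges_unique hm hM _ _ hl he).1 K _ _ le_rfl (by omega) (by omega) (by omega)
        (key _ h hL) (key _ h' (by rw [hl, hL])) (by omega) hE

end SwitchCount
-- An optimal sequence of blocks and its length
namespace SwitchCount

/-- The blocks leading from the set of positions `[-(m + k), -m] ∪ {0}` to a single position. -/
def descent (m K : ℕ) : ℕ → List (ℕ × ℕ)
  | 0 => [(1, 0)]
  | k + 1 =>
    (if m + k + 1 ≤ K then (1, 0) :: List.replicate (m - 1) (0, 0)
      else (2, 0) :: List.replicate (K - 2 - k) (0, 0)) ++
    ((if k + 1 ≤ m then List.replicate (k + 1) (0, 0)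
      else (0, 1) :: List.replicate (m - 1) (0, 0)) ++ descent m K k)

/-- The cheapest sequence of blocks merging all positions modulo `m + K`. -/
def optimal (m K : ℕ) : List (ℕ × ℕ) := List.replicate (m - 1) (0, 0) ++ descent m K (K - 1)

theorem extra_replicate (r : ℕ) : extra (List.replicate r (0, 0)) = 0 := by
  simp [extra]

theorem length_descent {m K : ℕ} (hm : 1 ≤ m) {k : ℕ} (hk : k < K) :
    ((descent m K k).length : ℤ) = insVisits m (m + K) k := by
  induction k with
  | zero => simp [descent, insVisits]
  | succ k ih =>
    have := ih (by omega)
    simp only [descent, insVisits]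
    split_ifs <;> simp only [List.length_append, List.length_cons, List.length_replicate] <;> omega

theorem extra_descent {m K : ℕ} {k : ℕ} (hk : k < K) :
    (extra (descent m K k) : ℤ) = insExtra m (m + K) k := by
  induction k with
  | zero => simp [descent, insExtra]
  | succ k ih =>
    have := ih (by omega)
    simp only [descent, insExtra]
    split_ifs <;> simp only [extra_append, extra_cons, extra_replicate] <;> omega

theorem runSteps_replicate_of_not_dvd {m M : ℤ} (r : ℕ) (p : ℤ)
    (h : ∀ i : ℕ, i < r → ¬ M ∣ p - i) :
    runSteps m M (List.replicate r (0, 0)) p = p - r := by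
  induction r generalizing p with
  | zero => simp [runSteps]
  | succ r ih =>
    rw [List.replicate_succ, runSteps_cons, step_of_not_dvd (by simpa using h 0 (by omega))]
    simp only [Nat.zero_mod, if_true]
    rw [ih]
    · push_cast; ring
    · intro i hi
      have := h (i + 1) (by omega)
      rwa [Nat.cast_add, Nat.cast_one, add_comm, ← sub_sub] at this

theorem runSteps_replicate_of_pos {m M : ℤ} (r : ℕ) (p : ℤ) (h : r ≤ p) (h' : p < M) :
    runSteps m M (List.replicate r (0, 0)) p = p - r :=
  runSteps_replicate_of_not_dvd r p fun i hi => not_dvd_of_pos (by omega) (by omega)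

theorem runSteps_replicate_of_neg {m M : ℤ} (r : ℕ) (p : ℤ) (h : p < 0) (h' : -M ≤ p - r) :
    runSteps m M (List.replicate r (0, 0)) p = p - r :=
  runSteps_replicate_of_not_dvd r p fun i hi => not_dvd_of_neg (by omega) (by omega)

theorem runSteps_replicate_of_lt {m M : ℤ} (r : ℕ) (p : ℤ) (hm : 0 < m) (hp : 0 ≤ p) (h : p < r)
    (h' : m + r - 1 ≤ M) :
    runSteps m M (List.replicate r (0, 0)) p = p + 1 - m - r := by
  lift p to ℕ using hp
  obtain ⟨r, rfl⟩ : ∃ r', r = p + (r' + 1) := ⟨r - p - 1, by omega⟩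
  rw [List.replicate_add, runSteps_append, runSteps_replicate_of_pos _ _ le_rfl (by omega),
    List.replicate_succ, runSteps_cons, sub_self, step_zero]
  simp only [Nat.zero_mod, if_true]
  rw [runSteps_replicate_of_neg _ _ (by omega) (by omega)]
  push_cast
  ring

/-- The blocks merge the positions `p` with the property `P` modulo `M`. -/
def MergesOn (m M : ℤ) (l : List (ℕ × ℕ)) (P : ℤ → Prop) : Prop :=
  ∃ c, ∀ p, P p → M ∣ runSteps m M l p - c

theorem dvd_runSteps_sub {m M : ℤ} (l : List (ℕ × ℕ)) {p c : ℤ}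
    (h : M ∣ runSteps m M l (p + M) - c) : M ∣ runSteps m M l p - c := by
  have := dvd_sub h (dvd_runSteps_add_sub (m := m) l p)
  rwa [sub_sub_sub_cancel_left] at this

/-- The exit merges 0 with one end of the interval and is followed by a rotation onto [0, k + 1]
modulo M; the entry then turns this into the set for k. -/
theorem mergesOn_descent {m K : ℕ} (hm : 1 ≤ m) (hK : m ≤ K) (k : ℕ) (hk : k < K) :
    MergesOn m (m + K) (descent m K k) (fun p => p = 0 ∨ -(m + k : ℤ) ≤ p ∧ p ≤ -m) := by
  induction k with
  | zero =>
    refine ⟨m - 1, fun p hp => ?_⟩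
    simp only [descent, runSteps_cons]
    rcases hp with rfl | hp
    · simp [step_zero, runSteps]
    · obtain rfl : p = -m := by push_cast at hp; omega
      rw [step_of_not_dvd (not_dvd_of_neg (by omega) (by omega))]
      simp [runSteps]
  | succ k ih =>
    obtain ⟨c, hc⟩ := ih (by omega)
    have enter : ∀ p : ℤ, 0 ≤ p → p ≤ k + 1 → (m + K : ℤ) ∣ runSteps m (m + K)
        ((if k + 1 ≤ m then List.replicate (k + 1) (0, 0)
          else (0, 1) :: List.replicate (m - 1) (0, 0)) ++ descent m K k) p - c := by
      intro p hp hp'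
      rw [runSteps_append]
      apply hc
      split_ifs with h
      · rcases hp'.lt_or_eq with hp' | rfl
        · rw [runSteps_replicate_of_lt _ _ (by omega) (by omega) (by omega) (by omega)]
          omega
        · rw [runSteps_replicate_of_pos _ _ (by omega) (by omega)]
          omega
      · rw [runSteps_cons]
        rcases hp.lt_or_eq with hp | rfl
        · rw [step_of_not_dvd (not_dvd_of_pos (by omega) (by omega))]
          simp only [Nat.zero_mod, Nat.one_mod, if_true, if_false, one_ne_zero]
          rw [runSteps_replicate_of_neg _ _ (by omega) (by omega)]
          omega
        · rw [step_zero]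
          simp only [Nat.zero_mod, Nat.one_mod, if_true, if_false, one_ne_zero]
          rw [runSteps_replicate_of_pos _ _ (by omega) (by omega)]
          omega
    refine ⟨c, fun p hp => ?_⟩
    rw [descent, runSteps_append]
    by_cases h1 : m + k + 1 ≤ K
    · rw [if_pos h1, runSteps_cons]
      rcases hp with rfl | hp
      · rw [step_zero]
        simp only [Nat.zero_mod, Nat.one_mod, if_true, if_false, one_ne_zero]
        rw [runSteps_replicate_of_pos _ _ (by omega) (by omega)]
        exact enter _ (by omega) (by omega)
      · rw [step_of_not_dvd (not_dvd_of_neg (by omega) (by omega))]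
        simp only [Nat.zero_mod, Nat.one_mod, if_true, if_false, one_ne_zero]
        rw [runSteps_replicate_of_pos _ _ (by omega) (by omega)]
        exact enter _ (by omega) (by omega)
    · rw [if_neg h1, runSteps_cons]
      -- After (2, 0) and K - 2 - k rotations the positions lie in [-M, -M + k + 1], with M = m + K,
      -- hence the shift by M.
      apply dvd_runSteps_sub
      rcases hp with rfl | hp
      · rw [step_zero]
        simp only [Nat.zero_mod, Nat.mod_self, if_true, if_false, two_ne_zero, zero_ne_one]
        rw [runSteps_replicate_of_neg _ _ (by omega) (by omega)]
        exact enter _ (by omega) (by omega)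
      · rw [step_of_not_dvd (not_dvd_of_neg (by omega) (by omega))]
        simp only [Nat.zero_mod, Nat.mod_self, if_true]
        rw [runSteps_replicate_of_neg _ _ (by omega) (by omega)]
        exact enter _ (by omega) (by omega)

theorem dvd_runSteps_sub_runSteps {m M : ℤ} (l : List (ℕ × ℕ)) {p q : ℤ} (h : M ∣ p - q) :
    M ∣ runSteps m M l p - runSteps m M l q := by
  obtain ⟨c, hc⟩ := h
  obtain rfl : p = q + c * M := by rw [mul_comm, ← hc]; ring
  clear hc
  induction c using Int.induction_on with
  | zero => simp
  | succ c ih =>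
    have := dvd_add (dvd_runSteps_add_sub (m := m) l (q + c * M)) ih
    rwa [sub_add_sub_cancel, add_assoc, ← add_one_mul] at this
  | pred c ih =>
    have := dvd_runSteps_add_sub (m := m) (M := M) l (q + (-c - 1) * M)
    rw [add_assoc, ← add_one_mul, sub_add_cancel] at this
    have := dvd_sub ih this
    rwa [sub_sub_sub_cancel_left] at this

theorem mergesOn_optimal {m K : ℕ} (hm : 1 ≤ m) (hK : m ≤ K) :
    MergesOn m (m + K) (optimal m K) (fun _ => True) := by
  obtain ⟨c, hc⟩ := mergesOn_descent hm hK (K - 1) (by omega)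
  have key : ∀ p : ℤ, 0 ≤ p → p < m + K →
      (m + K : ℤ) ∣ runSteps m (m + K) (optimal m K) p - c := by
    intro p hp hp'
    rw [optimal, runSteps_append]
    rcases lt_or_ge p (m - 1 : ℕ) with h | h
    · rw [runSteps_replicate_of_lt _ _ (by omega) (by omega) (by omega) (by omega)]
      apply hc
      omega
    · rw [runSteps_replicate_of_pos _ _ (by omega) (by omega)]
      rcases h.lt_or_eq with h | rfl
      · rw [← sub_add_cancel (p - (m - 1 : ℕ)) (m + K : ℤ)]
        have h1 := hc (p - (m - 1 : ℕ) - (m + K)) (by omega)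
        have := dvd_add (dvd_runSteps_add_sub (m := m) (descent m K (K - 1))
          (p - (m - 1 : ℕ) - (m + K))) h1
        rwa [sub_add_sub_cancel] at this
      · apply hc
        omega
  refine ⟨c, fun p _ => ?_⟩
  have h1 := key (p % (m + K)) (Int.emod_nonneg _ (by omega)) (Int.emod_lt_of_pos _ (by omega))
  have h2 := dvd_runSteps_sub_runSteps (m := m) (M := m + K) (optimal m K)
    (Int.dvd_self_sub_emod (x := p) (m := (m + K : ℤ)))
  have := dvd_add h2 h1
  rwa [sub_add_sub_cancel] at this

theorem two_mul_sum_min (m k : ℕ) (hm : 1 ≤ m) (hk : m ≤ k + 1) :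
    2 * ∑ j ∈ Finset.range k, min (j : ℤ) (m - 1) = (m - 1) * (2 * k - m) := by
  obtain ⟨m, rfl⟩ := Nat.exists_eq_add_of_le' hm
  obtain ⟨k, rfl⟩ := Nat.exists_eq_add_of_le (Nat.le_of_succ_le_succ hk)
  have h1 : ∀ j ∈ Finset.range m, min (j : ℤ) ((m + 1 : ℕ) - 1) = (j : ℕ) := by
    intro j hj
    rw [Finset.mem_range] at hj
    omega
  have h2 : ∀ j ∈ Finset.range k, min ((m + j : ℕ) : ℤ) ((m + 1 : ℕ) - 1) = m := by
    intro j hj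
    omega
  rw [Finset.sum_range_add, Finset.sum_congr rfl h1, Finset.sum_congr rfl h2, Finset.sum_const,
    Finset.card_range, mul_add]
  have h3 := Finset.sum_range_id_mul_two m
  have h4 : 2 * ∑ j ∈ Finset.range m, (j : ℤ) = m * (m - 1) := by
    rcases m with _ | m
    · simp
    · rw [Nat.add_sub_cancel] at h3
      have : (((∑ j ∈ Finset.range (m + 1), j) * 2 : ℕ) : ℤ) = ((m + 1) * m : ℕ) := by rw [h3]
      push_cast at this ⊢
      linarith
  rw [h4]
  push_cast
  simp only [nsmul_eq_mul]
  ring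

theorem insVisits_eq_sum (m M : ℤ) (k : ℕ) : insVisits m M k = 1 + 2 * k +
    ∑ j ∈ Finset.range k, min (j : ℤ) (m - 1) +
      ∑ j ∈ Finset.range k, min (M - m - 2 - j) (m - 1) := by
  induction k with
  | zero => simp [insVisits]
  | succ k ih =>
    rw [insVisits, ih, Finset.sum_range_succ, Finset.sum_range_succ, min_comm (m - 1)]
    push_cast
    ring

/-- The length of the cheapest sequence of blocks. -/
theorem insVisits_eq {m K : ℕ} (hm : 1 ≤ m) (hK : m ≤ K) :
    m - 1 + insVisits m (m + K) (K - 1) = m * (2 * K - m) := by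
  have h1 : ∑ j ∈ Finset.range (K - 1), min ((m + K : ℤ) - m - 2 - j) (m - 1) =
      ∑ j ∈ Finset.range (K - 1), min (j : ℤ) (m - 1) := by
    -- The reflection j ↦ K - 2 - j identifies the two sums of minima.
    rw [← Finset.sum_range_reflect]
    refine Finset.sum_congr rfl fun j hj => ?_
    rw [Finset.mem_range] at hj
    congr 1
    omega
  have h2 := two_mul_sum_min m (K - 1) hm (by omega)
  rw [insVisits_eq_sum, h1]
  have h3 : ((K - 1 : ℕ) : ℤ) = K - 1 := by omega
  rw [h3] at h2 ⊢
  linarith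

end SwitchCount
-- The automaton as reflections of a cycle
namespace SwitchCount

/-- The letter that moves the state `n - 1` to `n`. -/
def inner (n : ℕ) : Letter := if n % 2 = 0 then .b else .a

/-- The letter that does not move the state `n - 1` to `n`. -/
def outer (n : ℕ) : Letter := if n % 2 = 0 then .a else .b

theorem inner_ne_outer (n : ℕ) : inner n ≠ outer n := by
  unfold inner outer; split_ifs <;> simp

theorem eq_inner_or_eq_outer (n : ℕ) (z : Letter) : z = inner n ∨ z = outer n := by
  unfold inner outer; split_ifs <;> cases z <;> simp

/-- The state with the lifted position `p`. -/
def posNat (n : ℕ) (p : ℤ) : ℕ :=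
  if 2 * (p % (n - 1)) < n - 1 then (n - 1 - 2 * (p % (n - 1))).toNat
  else (2 * (p % (n - 1)) + 2 - n).toNat

theorem emod_eq_of_dvd_sub {M p q : ℤ} (h : M ∣ p - q) : p % M = q % M :=
  (Int.modEq_iff_dvd.2 h).symm

theorem posNat_congr {n : ℕ} {p q : ℤ} (h : (n - 1 : ℤ) ∣ p - q) : posNat n p = posNat n q := by
  unfold posNat
  rw [emod_eq_of_dvd_sub h]

theorem dvd_of_posNat_eq {n : ℕ} (hn : 3 ≤ n) {p q : ℤ} (h : posNat n p = posNat n q) :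
    (n - 1 : ℤ) ∣ p - q := by
  apply Int.ModEq.dvd
  unfold Int.ModEq
  have h1 := Int.emod_nonneg p (show (n - 1 : ℤ) ≠ 0 by omega)
  have h2 := Int.emod_lt_of_pos p (show (0 : ℤ) < n - 1 by omega)
  have h3 := Int.emod_nonneg q (show (n - 1 : ℤ) ≠ 0 by omega)
  have h4 := Int.emod_lt_of_pos q (show (0 : ℤ) < n - 1 by omega)
  unfold posNat at h
  generalize p % (n - 1 : ℤ) = r at *
  generalize q % (n - 1 : ℤ) = r' at *
  split_ifs at h <;> omega

theorem posNat_mem {n : ℕ} (hn : 3 ≤ n) (p : ℤ) : 1 ≤ posNat n p ∧ posNat n p < n := by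
  have h1 := Int.emod_nonneg p (show (n - 1 : ℤ) ≠ 0 by omega)
  have h2 := Int.emod_lt_of_pos p (show (0 : ℤ) < n - 1 by omega)
  unfold posNat
  split_ifs <;> omega

theorem exists_posNat {n q : ℕ} (h1 : 1 ≤ q) (h2 : q < n) : ∃ p, posNat n p = q := by
  rcases Nat.even_or_odd' (n - 1 - q) with ⟨c, hc | hc⟩
  · refine ⟨c, ?_⟩
    unfold posNat
    rw [Int.emod_eq_of_lt (by omega) (by omega), if_pos (by omega)]
    omega
  · refine ⟨n - 2 - c, ?_⟩
    unfold posNat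
    rw [Int.emod_eq_of_lt (by omega) (by omega), if_neg (by omega)]
    omega

theorem neg_one_sub_emod {M : ℤ} (hM : 0 < M) (p : ℤ) : (-1 - p) % M = M - 1 - p % M := by
  have h1 := Int.emod_nonneg p hM.ne'
  have h2 := Int.emod_lt_of_pos p hM
  conv_rhs => rw [← Int.emod_eq_of_lt (a := M - 1 - p % M) (b := M) (by omega) (by omega)]
  apply emod_eq_of_dvd_sub
  refine ⟨-1 - p / M, ?_⟩
  have := Int.emod_add_mul_ediv p M
  linarith

theorem neg_emod_of_not_dvd {M : ℤ} (hM : 0 < M) {p : ℤ} (h : ¬ M ∣ p) :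
    (-p) % M = M - p % M := by
  have h1 := Int.emod_nonneg p hM.ne'
  have h2 := Int.emod_lt_of_pos p hM
  have h3 : p % M ≠ 0 := fun h' => h (Int.dvd_of_emod_eq_zero h')
  conv_rhs => rw [← Int.emod_eq_of_lt (a := M - p % M) (b := M) (by omega) (by omega)]
  apply emod_eq_of_dvd_sub
  refine ⟨-1 - p / M, ?_⟩
  have := Int.emod_add_mul_ediv p M
  linarith

/-- States n - 1, n - 3, … sit at 0, 1, … and n - 2, n - 4, … at -1, -2, …, so the swaps along the
path become a reflection. -/
theorem stepNat_outer {n : ℕ} (hn : 3 ≤ n) (p : ℤ) :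
    stepNat n (posNat n p) (outer n) = posNat n (-1 - p) := by
  have h0 := posNat_mem hn p
  have h1 := Int.emod_nonneg p (show (n - 1 : ℤ) ≠ 0 by omega)
  have h2 := Int.emod_lt_of_pos p (show (0 : ℤ) < n - 1 by omega)
  have h3 := neg_one_sub_emod (show (0 : ℤ) < n - 1 by omega) p
  unfold posNat at *
  rw [h3]
  generalize p % (n - 1 : ℤ) = r at *
  unfold outer
  split_ifs at h0 ⊢ <;> simp only [stepNat] <;> split_ifs <;> omega

theorem stepNat_inner {n : ℕ} (hn : 3 ≤ n) {p : ℤ} (h : ¬ (n - 1 : ℤ) ∣ p) :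
    stepNat n (posNat n p) (inner n) = posNat n (-p) := by
  have h0 := posNat_mem hn p
  have h1 := Int.emod_nonneg p (show (n - 1 : ℤ) ≠ 0 by omega)
  have h2 := Int.emod_lt_of_pos p (show (0 : ℤ) < n - 1 by omega)
  have h3 := neg_emod_of_not_dvd (show (0 : ℤ) < n - 1 by omega) h
  have h4 : p % (n - 1) ≠ 0 := fun h' => h (Int.dvd_of_emod_eq_zero h')
  unfold posNat at *
  rw [h3]
  generalize p % (n - 1 : ℤ) = r at *
  unfold inner
  split_ifs at h0 ⊢ <;> simp only [stepNat] <;> split_ifs <;> omega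

theorem stepNat_inner_of_dvd {n : ℕ} (hn : 3 ≤ n) {p : ℤ} (h : (n - 1 : ℤ) ∣ p) :
    stepNat n (posNat n p) (inner n) = n := by
  have h4 : p % (n - 1) = 0 := Int.emod_eq_zero_of_dvd h
  unfold posNat
  rw [h4, if_pos (by omega)]
  unfold inner
  split_ifs <;> simp only [stepNat] <;> split_ifs <;> omega

theorem stepNat_last {n : ℕ} (hn : 3 ≤ n) (z : Letter) :
    stepNat n n z = posNat n (-(n / 3 : ℕ)) := by
  have h : stepNat n n z = target n := by cases z <;> simp [stepNat]
  rw [h, posNat, neg_emod_of_not_dvd (by omega) (not_dvd_of_pos (by omega) (by omega)),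
    Int.emod_eq_of_lt (by omega) (by omega)]
  unfold target
  split_ifs <;> omega

theorem run_val {n : ℕ} (w : List Letter) (q : State n) :
    (run (A n) q w).1 = w.foldl (stepNat n) q.1 := by
  induction w generalizing q with
  | nil => rfl
  | cons z w ih => exact ih _

theorem isSynchronizing_iff {n : ℕ} (hn : 3 ≤ n) (w : List Letter) :
    IsSynchronizing (A n) w ↔ ∃ s, ∀ q, 1 ≤ q → q ≤ n → w.foldl (stepNat n) q = s := by
  constructor
  · rintro ⟨s, hs⟩
    refine ⟨s.1, fun q h1 h2 => ?_⟩
    rw [← hs ⟨q, Finset.mem_Icc.2 ⟨h1, h2⟩⟩, run_val]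
  · rintro ⟨s, hs⟩
    refine ⟨run (A n) ⟨1, Finset.mem_Icc.2 ⟨le_rfl, by omega⟩⟩ w, fun q => Subtype.ext ?_⟩
    have := Finset.mem_Icc.1 q.2
    rw [run_val, run_val, hs _ this.1 this.2, hs _ le_rfl (by omega)]

/-- The word of a sequence of blocks. -/
def blocks (n : ℕ) (l : List (ℕ × ℕ)) : List Letter :=
  l.flatMap fun o => List.replicate (o.1 + 1) (inner n) ++ List.replicate (o.2 + 1) (outer n)

theorem blocks_cons (n : ℕ) (o : ℕ × ℕ) (l : List (ℕ × ℕ)) : blocks n (o :: l) =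
    List.replicate (o.1 + 1) (inner n) ++ (List.replicate (o.2 + 1) (outer n) ++ blocks n l) := by
  simp [blocks]

theorem foldl_replicate_outer {n : ℕ} (hn : 3 ≤ n) (j : ℕ) (p : ℤ) :
    (List.replicate j (outer n)).foldl (stepNat n) (posNat n p) =
      posNat n (if j % 2 = 0 then p else -1 - p) := by
  induction j generalizing p with
  | zero => rfl
  | succ j ih =>
    rw [List.replicate_succ, List.foldl_cons, stepNat_outer hn, ih]
    congr 1
    split_ifs <;> omega

theorem foldl_replicate_inner {n : ℕ} (hn : 3 ≤ n) (j : ℕ) {p : ℤ} (h : ¬ (n - 1 : ℤ) ∣ p) :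
    (List.replicate j (inner n)).foldl (stepNat n) (posNat n p) =
      posNat n (if j % 2 = 0 then p else -p) := by
  induction j generalizing p with
  | zero => rfl
  | succ j ih =>
    rw [List.replicate_succ, List.foldl_cons, stepNat_inner hn h, ih (by rwa [dvd_neg])]
    congr 1
    split_ifs <;> omega

theorem foldl_block {n : ℕ} (hn : 3 ≤ n) (o : ℕ × ℕ) (p : ℤ) :
    (List.replicate (o.1 + 1) (inner n) ++ List.replicate (o.2 + 1) (outer n)).foldl (stepNat n)
      (posNat n p) = posNat n (step (n / 3 : ℕ) (n - 1) o p) := by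
  obtain ⟨i, k⟩ := o
  have hm : ¬ (n - 1 : ℤ) ∣ -(n / 3 : ℕ) := not_dvd_of_neg (by omega) (by omega)
  rw [List.foldl_append]
  by_cases h : (n - 1 : ℤ) ∣ p
  · rw [List.replicate_succ, List.foldl_cons, stepNat_inner_of_dvd hn h]
    rcases i with _ | i
    · rw [List.replicate_zero, List.foldl_nil, List.replicate_succ, List.foldl_cons,
        stepNat_last hn, foldl_replicate_outer hn]
      apply posNat_congr
      simp only [step, h, if_true]
      obtain ⟨c, hc⟩ := h
      split_ifs <;> first | exact ⟨c, by linarith⟩ | exact ⟨-c, by linarith⟩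
    · rw [List.replicate_succ, List.foldl_cons, stepNat_last hn, foldl_replicate_inner hn _ hm,
        foldl_replicate_outer hn]
      apply posNat_congr
      simp only [step, h, if_true, Nat.add_eq_zero_iff, one_ne_zero, and_false, if_false]
      obtain ⟨c, hc⟩ := h
      split_ifs <;> first | omega | exact ⟨c, by linarith⟩ | exact ⟨-c, by linarith⟩
  · rw [foldl_replicate_inner hn _ h, foldl_replicate_outer hn, step_of_not_dvd h]
    congr 1
    simp only
    split_ifs <;> omega

theorem foldl_blocks {n : ℕ} (hn : 3 ≤ n) (l : List (ℕ × ℕ)) (p : ℤ) :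
    (blocks n l).foldl (stepNat n) (posNat n p) =
      posNat n (runSteps (n / 3 : ℕ) (n - 1) l p) := by
  induction l generalizing p with
  | nil => rfl
  | cons o l ih =>
    rw [blocks_cons, ← List.append_assoc, List.foldl_append, foldl_block hn, ih]
    rfl

end SwitchCount
-- Words, blocks and switch counts
namespace SwitchCount

theorem wordSwitchCount_cons_ne {z z' : Letter} (h : z ≠ z') (w : List Letter) :
    wordSwitchCount (z :: z' :: w) = 1 + wordSwitchCount (z' :: w) := by
  simp [wordSwitchCount, h]

theorem wordSwitchCount_replicate_append {z z' : Letter} (h : z ≠ z') (j : ℕ) (w : List Letter) :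
    wordSwitchCount (List.replicate (j + 1) z ++ z' :: w) = 1 + wordSwitchCount (z' :: w) := by
  induction j with
  | zero => exact wordSwitchCount_cons_ne h w
  | succ j ih =>
    rw [← ih]
    simp [List.replicate_succ, wordSwitchCount]

theorem wordSwitchCount_replicate (z : Letter) (j : ℕ) :
    wordSwitchCount (List.replicate (j + 1) z) = 1 := by
  induction j with
  | zero => rfl
  | succ j ih =>
    rw [List.replicate_succ, List.replicate_succ, wordSwitchCount, if_pos rfl,
      ← List.replicate_succ, ih]

theorem wordSwitchCount_append_singleton {z z' : Letter} (h : z ≠ z') (w : List Letter) :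
    wordSwitchCount (w ++ [z] ++ [z']) = wordSwitchCount (w ++ [z]) + 1 := by
  induction w with
  | nil => simp [wordSwitchCount, h]
  | cons c w ih =>
    rcases w with _ | ⟨d, w⟩
    · simp only [List.nil_append, List.cons_append, wordSwitchCount, h, if_false]
      split_ifs <;> rfl
    · simp only [List.cons_append, wordSwitchCount] at ih ⊢
      split_ifs <;> omega

theorem wordSwitchCount_blocks {n : ℕ} (l : List (ℕ × ℕ)) :
    wordSwitchCount (blocks n l) = 2 * l.length := by
  induction l with
  | nil => rfl
  | cons o l ih =>
    rw [blocks_cons, List.replicate_succ (n := o.2), List.cons_append,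
      wordSwitchCount_replicate_append (inner_ne_outer n), ← List.cons_append,
      ← List.replicate_succ]
    rcases l with _ | ⟨o', l⟩
    · simp [blocks, wordSwitchCount_replicate]
    · rw [blocks_cons, List.replicate_succ (n := o'.1), List.cons_append] at ih ⊢
      rw [wordSwitchCount_replicate_append (inner_ne_outer n).symm, ih]
      simp only [List.length_cons]
      ring

theorem wordSwitchCount_replicate_append_blocks {n : ℕ} (j : ℕ) (l : List (ℕ × ℕ)) :
    wordSwitchCount (List.replicate (j + 1) (outer n) ++ blocks n l) = 1 + 2 * l.length := by
  rcases l with _ | ⟨o, l⟩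
  · simp [blocks, wordSwitchCount_replicate]
  · rw [← wordSwitchCount_blocks (n := n), blocks_cons, List.replicate_succ (n := o.1),
      List.cons_append, wordSwitchCount_replicate_append (inner_ne_outer n).symm]

theorem length_blocks (n : ℕ) (l : List (ℕ × ℕ)) :
    (blocks n l).length = 2 * l.length + extra l := by
  induction l with
  | nil => rfl
  | cons o l ih =>
    rw [blocks_cons]
    simp only [List.length_append, List.length_replicate, ih, List.length_cons, extra_cons]
    ring

theorem exists_eq_blocks {n : ℕ} (v : List Letter) :
    ∃ j l, v ++ [outer n] = List.replicate j (outer n) ++ blocks n l := by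
  induction v with
  | nil => exact ⟨1, [], rfl⟩
  | cons z v ih =>
    obtain ⟨j, l, h⟩ := ih
    rcases eq_inner_or_eq_outer n z with rfl | rfl
    · rcases j with _ | j
      · rcases l with _ | ⟨⟨i, k⟩, l⟩
        · simp [blocks] at h
        · refine ⟨0, (i + 1, k) :: l, ?_⟩
          rw [List.cons_append, h, blocks_cons, blocks_cons]
          rfl
      · refine ⟨0, (0, j) :: l, ?_⟩
        rw [List.cons_append, h, blocks_cons]
        rfl
    · refine ⟨j + 1, l, ?_⟩
      rw [List.cons_append, h]
      rfl

theorem mergesOff_of_isSynchronizing {n : ℕ} (hn : 3 ≤ n) {j : ℕ} {l : List (ℕ × ℕ)}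
    (h : IsSynchronizing (A n) (List.replicate j (outer n) ++ blocks n l)) :
    MergesOff (n / 3 : ℕ) (n - 1) l 0 0 := by
  obtain ⟨s, hs⟩ := (isSynchronizing_iff hn _).1 h
  have key : ∀ p, posNat n (runSteps (n / 3 : ℕ) (n - 1) l p) = s := by
    intro p
    have := posNat_mem hn (if j % 2 = 0 then p else -1 - p)
    rw [← hs _ this.1 this.2.le, List.foldl_append, foldl_replicate_outer hn, foldl_blocks hn]
    congr 2
    split_ifs <;> ring
  intro p q _ _ _ _
  exact dvd_of_posNat_eq hn ((key p).trans (key q).symm)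

theorem IsSynchronizing.append {n : ℕ} {w : List Letter} (h : IsSynchronizing (A n) w)
    (w' : List Letter) : IsSynchronizing (A n) (w ++ w') := by
  obtain ⟨s, hs⟩ := h
  exact ⟨run (A n) s w', fun q => by
    rw [← hs q]
    simp [run]⟩

/-- A lower bound for the switch count, with the shape of the words that attain it. -/
theorem le_wordSwitchCount {n K : ℕ} (hn : 3 ≤ n) (hK : n / 3 + K = n - 1) {w : List Letter}
    (h : IsSynchronizing (A n) w) :
    2 * ((n / 3 : ℕ) * (2 * K - (n / 3 : ℕ))) - 1 ≤ (wordSwitchCount w : ℤ) ∧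
    ((wordSwitchCount w : ℤ) = 2 * ((n / 3 : ℕ) * (2 * K - (n / 3 : ℕ))) - 1 →
      ∃ l, w ++ [outer n] = blocks n l ∧
        (l.length : ℤ) = (n / 3 : ℕ) * (2 * K - (n / 3 : ℕ)) ∧
        insExtra (n / 3 : ℕ) (n - 1) (K - 1) ≤ extra l ∧ MergesOff (n / 3 : ℕ) (n - 1) l 0 0) := by
  have hM : ((n / 3 : ℕ) + K : ℤ) = n - 1 := by omega
  have bound : ∀ j l, IsSynchronizing (A n) (List.replicate j (outer n) ++ blocks n l) →
      CostLe ((n / 3 : ℕ) * (2 * K - (n / 3 : ℕ))) (insExtra (n / 3 : ℕ) (n - 1) (K - 1)) l := by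
    intro j l h
    -- Here K = M - m, whereas the index of the arcs is M - m - 1.
    have := costLe_of_mergesOff (m := (n / 3 : ℕ)) (M := n - 1) (by omega) (by omega)
      (K := K - 1) (by omega) l 0 0 le_rfl le_rfl (by omega) (mergesOff_of_isSynchronizing hn h)
    rw [← insVisits_eq (by omega) (by omega), hM]
    simpa using this
  rcases List.eq_nil_or_concat w with rfl | ⟨v, z, rfl⟩
  · obtain ⟨s, hs⟩ := (isSynchronizing_iff hn _).1 h
    have h1 := hs 1 le_rfl (by omega)
    have h2 := hs 2 (by omega) (by omega)
    simp only [List.foldl_nil] at h1 h2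
    omega
  -- A word ending in `inner` needs one more `outer` to complete its last block. A first or a last
  -- letter `outer` costs a switch, so neither occurs at equality.
  · rcases eq_inner_or_eq_outer n z with rfl | rfl
    · obtain ⟨j, l, hl⟩ := exists_eq_blocks (n := n) (v ++ [inner n])
      have h' := h.append [outer n]
      have hc := wordSwitchCount_append_singleton (inner_ne_outer n) v
      rw [hl] at hc
      rw [List.concat_eq_append, hl] at h'
      have hb := bound j l h'
      unfold CostLe at hb
      rw [List.concat_eq_append] at *
      rcases j with _ | j
      · rw [List.replicate_zero, List.nil_append, wordSwitchCount_blocks] at hc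
        refine ⟨by omega, fun he => ⟨l, by simpa using hl, by omega, by omega, ?_⟩⟩
        exact mergesOff_of_isSynchronizing hn h'
      · rw [wordSwitchCount_replicate_append_blocks] at hc
        refine ⟨by omega, fun he => ?_⟩
        omega
    · obtain ⟨j, l, hl⟩ := exists_eq_blocks (n := n) v
      rw [List.concat_eq_append] at *
      rw [hl] at h ⊢
      have hb := bound j l h
      unfold CostLe at hb
      rcases j with _ | j
      · rw [List.replicate_zero, List.nil_append, wordSwitchCount_blocks]
        refine ⟨by omega, fun he => ?_⟩
        omega
      · rw [wordSwitchCount_replicate_append_blocks]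
        refine ⟨by omega, fun he => ?_⟩
        omega

theorem exists_descent_eq (m K k : ℕ) : ∃ u, descent m K k = u ++ [(1, 0)] := by
  induction k with
  | zero => exact ⟨[], rfl⟩
  | succ k ih =>
    obtain ⟨u, hu⟩ := ih
    rw [descent, hu]
    exact ⟨_, by rw [← List.append_assoc, ← List.append_assoc]⟩

theorem exists_blocks_optimal (n m K : ℕ) :
    ∃ u, optimal m K = u ++ [(1, 0)] ∧
      blocks n u ++ List.replicate 2 (inner n) ++ [outer n] = blocks n (optimal m K) := by
  obtain ⟨u, hu⟩ := exists_descent_eq m K (K - 1)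
  refine ⟨List.replicate (m - 1) (0, 0) ++ u, ?_, ?_⟩
  · rw [optimal, hu, List.append_assoc]
  · rw [optimal, hu]
    simp [blocks]

theorem exists_cons_of_append_eq_blocks {n : ℕ} {w : List Letter} {l : List (ℕ × ℕ)}
    (hl : l ≠ []) (h : w ++ [outer n] = blocks n l) : ∃ w', w = inner n :: w' := by
  rcases l with _ | ⟨o, l⟩
  · exact absurd rfl hl
  · rw [blocks_cons, List.replicate_succ, List.cons_append] at h
    rcases w with _ | ⟨z, w⟩
    · exact absurd (List.cons.inj h).1 (inner_ne_outer n).symm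
    · exact ⟨w, by rw [(List.cons.inj h).1]⟩

/-- Since `w` ends in two letters `inner`, its image of the positions avoids the last state; there
`outer` is injective, so removing it keeps the images merged. -/
theorem isSynchronizing_of_append {n K : ℕ} (hn : 3 ≤ n) (hK : n / 3 + K = n - 1) {w : List Letter}
    (h : w ++ [outer n] = blocks n (optimal (n / 3) K)) : IsSynchronizing (A n) w := by
  obtain ⟨u, hu, hu'⟩ := exists_blocks_optimal n (n / 3) K
  have hM : ((n / 3 : ℕ) + K : ℤ) = n - 1 := by omega
  obtain ⟨c, hc⟩ := mergesOn_optimal (m := n / 3) (K := K) (by omega) (by omega)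
  rw [hM] at hc
  have hm : ¬ (n - 1 : ℤ) ∣ (n / 3 : ℕ) := not_dvd_of_pos (by omega) (by omega)
  have hw := List.append_cancel_right (h.trans hu'.symm)
  have image : ∀ p, ∃ a, w.foldl (stepNat n) (posNat n p) = posNat n a := by
    intro p
    rw [hw, List.foldl_append, foldl_blocks hn]
    by_cases h : (n - 1 : ℤ) ∣ runSteps (n / 3 : ℕ) (n - 1) u p
    · exact ⟨_, by
        rw [List.replicate_succ, List.foldl_cons, stepNat_inner_of_dvd hn h, List.replicate_one,
          List.foldl_cons, stepNat_last hn, List.foldl_nil]⟩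
    · exact ⟨_, foldl_replicate_inner hn 2 h⟩
  have key : ∀ p, w.foldl (stepNat n) (posNat n p) = posNat n (-1 - c) := by
    intro p
    obtain ⟨a, ha⟩ := image p
    have h1 := foldl_blocks hn (optimal (n / 3) K) p
    rw [← h, List.foldl_append, ha, List.foldl_cons, stepNat_outer hn, List.foldl_nil] at h1
    have h2 := dvd_add (dvd_of_posNat_eq hn h1) (hc p trivial)
    rw [ha]
    apply posNat_congr
    rw [← dvd_neg]
    convert h2 using 1
    ring
  refine (isSynchronizing_iff hn w).2 ⟨posNat n (-1 - c), fun q h1 h2 => ?_⟩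
  rcases h2.lt_or_eq with h2 | rfl
  · obtain ⟨p, rfl⟩ := exists_posNat h1 h2
    exact key p
  · obtain ⟨w', rfl⟩ := exists_cons_of_append_eq_blocks (by rw [hu]; simp) h
    -- The last state joins position m after the first letter, as `inner` sends both to -m.
    rw [← key (q / 3 : ℕ), List.foldl_cons, List.foldl_cons, stepNat_last hn, stepNat_inner hn hm]

theorem length_optimal {m K : ℕ} (hm : 1 ≤ m) (hK : m ≤ K) :
    ((optimal m K).length : ℤ) = m * (2 * K - m) := by
  rw [← insVisits_eq hm hK, ← length_descent hm (by omega), optimal, List.length_append,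
    List.length_replicate]
  omega

theorem extra_optimal {m K : ℕ} (hm : 1 ≤ m) (hK : m ≤ K) :
    (extra (optimal m K) : ℤ) = insExtra m (m + K) (K - 1) := by
  rw [← extra_descent (by omega), optimal, extra_append, extra_replicate, zero_add]

theorem wordSwitchCount_of_append {n : ℕ} {w : List Letter} {l : List (ℕ × ℕ)}
    (hl : ∃ u, l = u ++ [(1, 0)]) (h : w ++ [outer n] = blocks n l) :
    wordSwitchCount w + 1 = 2 * l.length := by
  rw [← wordSwitchCount_blocks (n := n), ← h]
  obtain ⟨u, rfl⟩ := hl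
  have : w = (blocks n u ++ [inner n]) ++ [inner n] := by
    refine List.append_cancel_right (h.trans (?_ : _ = _ ++ [outer n]))
    simp [blocks, List.replicate_succ]
  rw [this, wordSwitchCount_append_singleton (inner_ne_outer n)]

/-- The word of the cheapest sequence of blocks, without its last letter, is the unique shortest
word of minimal switch count. -/
theorem isShortestMinimal_iff {n K : ℕ} (hn : 3 ≤ n) (hK : n / 3 + K = n - 1) {w : List Letter}
    (h : w ++ [outer n] = blocks n (optimal (n / 3) K)) :
    (wordSwitchCount w : ℤ) = 2 * ((n / 3 : ℕ) * (2 * K - (n / 3 : ℕ))) - 1 ∧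
      ∀ v, IsShortestMinimal (A n) v ↔ v = w := by
  have hM : ((n / 3 : ℕ) + K : ℤ) = n - 1 := by omega
  have hs := isSynchronizing_of_append hn hK h
  obtain ⟨u, hu, -⟩ := exists_blocks_optimal n (n / 3) K
  have hc := wordSwitchCount_of_append ⟨u, hu⟩ h
  have hL := length_optimal (m := n / 3) (K := K) (by omega) (by omega)
  have hE := extra_optimal (m := n / 3) (K := K) (by omega) (by omega)
  rw [hM] at hE
  have hc' : (wordSwitchCount w : ℤ) = 2 * ((n / 3 : ℕ) * (2 * K - (n / 3 : ℕ))) - 1 := by omega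
  have hlen := congrArg List.length h
  rw [length_blocks, List.length_append, List.length_singleton] at hlen
  have hmin : IsMinimal (A n) w := ⟨hs, fun v hv => by
    have := (le_wordSwitchCount hn hK hv).1
    omega⟩
  have hshape : ∀ v, IsMinimal (A n) v → ∃ l, v ++ [outer n] = blocks n l ∧
      l.length = (optimal (n / 3) K).length ∧ extra (optimal (n / 3) K) ≤ extra l ∧
      MergesOff (n / 3 : ℕ) (n - 1) l 0 0 := by
    intro v hv
    have h1 := hv.2 w hs
    have h2 := hmin.2 v hv.1
    obtain ⟨l, hl, h3, h4, h5⟩ := (le_wordSwitchCount hn hK hv.1).2 (by omega)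
    exact ⟨l, hl, by omega, by omega, h5⟩
  have hshort : IsShortestMinimal (A n) w := ⟨hmin, fun v hv => by
    obtain ⟨l, hl, h1, h2, -⟩ := hshape v hv
    have := congrArg List.length hl
    rw [length_blocks, List.length_append, List.length_singleton] at this
    omega⟩
  refine ⟨hc', fun v => ⟨fun hv => ?_, fun hv => hv ▸ hshort⟩⟩
  obtain ⟨l, hl, h1, h2, h3⟩ := hshape v hv.1
  have h4 := hv.2 w hmin
  have := congrArg List.length hl
  rw [length_blocks, List.length_append, List.length_singleton] at this
  have h5 : MergesOff (n / 3 : ℕ) (n - 1) (optimal (n / 3) K) 0 0 := by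
    have := hs.append [outer n]
    rw [h] at this
    exact mergesOff_of_isSynchronizing hn (j := 0) this
  have h6 : l = optimal (n / 3) K :=
    mergesOff_unique (m := (n / 3 : ℕ)) (M := n - 1) (K := K - 1) (by omega) (by omega) (by omega)
      _ _ h1 (by omega) 0 le_rfl (by omega) h5 h3
      (by
        have := insVisits_eq (m := n / 3) (K := K) (by omega) (by omega)
        rw [hM] at this
        omega) hE
  rw [h6, ← h] at hl
  exact List.append_cancel_right hl

end SwitchCount
-- The explicit word and the closed formula
namespace SwitchCount

theorem wpow_zero (u : List Letter) : wpow u 0 = [] := rfl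

theorem wpow_succ (u : List Letter) (k : ℕ) : wpow u (k + 1) = u ++ wpow u k := by
  simp [wpow, List.replicate_succ]

theorem wpow_add (u : List Letter) (j k : ℕ) : wpow u (j + k) = wpow u j ++ wpow u k := by
  rw [wpow, List.replicate_add, List.flatten_append]
  rfl

theorem append_wpow_comm (u v : List Letter) (k : ℕ) :
    u ++ wpow (v ++ u) k = wpow (u ++ v) k ++ u := by
  induction k with
  | zero => simp [wpow_zero]
  | succ k ih => rw [wpow_succ, wpow_succ, List.append_assoc v, ih]; simp

theorem blocks_append (n : ℕ) (l l' : List (ℕ × ℕ)) :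
    blocks n (l ++ l') = blocks n l ++ blocks n l' := by simp [blocks]

theorem blocks_replicate {n : ℕ} (hn : n % 2 = 0) (r : ℕ) :
    blocks n (List.replicate r (0, 0)) = wpow [.b, .a] r := by
  induction r with
  | zero => rfl
  | succ r ih =>
    rw [List.replicate_succ, blocks_cons, ih, wpow_succ]
    simp [inner, outer, hn]

/-- Rounds with exit (1, 0) and entry (0, 0). The factors of the word are cut one letter after the
start of a block, hence the leading b. -/
theorem blocks_descent_late {m : ℕ} (hm : (3 * m) % 2 = 0) (r : ℕ) (hr : r + 1 ≤ m) :
    [.b] ++ (List.Ico (2 * m - r) (2 * m)).flatMap (fun k => wpow [.b, .a] (3 * m - k) ++ [.b])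
      ++ [.b, .a] = blocks (3 * m) (descent m (2 * m - 1) r) := by
  induction r with
  | zero => simp [descent, blocks, inner, outer, hm, List.replicate_succ]
  | succ r ih =>
    rw [List.Ico.eq_cons (by omega), List.flatMap_cons, descent, if_pos (by omega),
      if_pos (by omega), blocks_append, blocks_append, blocks_cons, blocks_replicate hm,
      blocks_replicate hm, ← ih (by omega), show 2 * m - (r + 1) + 1 = 2 * m - r by omega,
      show 3 * m - (2 * m - (r + 1)) = 1 + ((m - 1) + (r + 1)) by omega, wpow_add, wpow_add,
      wpow_succ]
    simp [inner, outer, hm, wpow_zero, List.replicate_succ]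

/-- The single round that combines exit (2, 0) with entry (0, 0). -/
theorem blocks_descent_middle {m : ℕ} (hm : (3 * m) % 2 = 0) (hm2 : 2 ≤ m) :
    [.b] ++ ([.b] ++ wpow [.b, .a] (2 * m - 1) ++ [.b] ++
      (List.Ico (m + 1) (2 * m)).flatMap (fun k => wpow [.b, .a] (3 * m - k) ++ [.b])
      ++ [.b, .a]) = blocks (3 * m) (descent m (2 * m - 1) m) := by
  obtain ⟨m, rfl⟩ := Nat.exists_eq_add_of_le' hm2
  have h := blocks_descent_late hm (m + 1) (by omega)
  rw [show 2 * (m + 2) - (m + 1) = m + 2 + 1 by omega] at h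
  rw [descent, if_neg (by omega), if_pos (by omega), blocks_append, blocks_append, blocks_cons,
    blocks_replicate hm, blocks_replicate hm, ← h,
    show 2 * (m + 2) - 1 - 2 - (m + 1) = m by omega,
    show 2 * (m + 2) - 1 = 1 + (m + (m + 1 + 1)) by omega, wpow_add, wpow_add, wpow_succ]
  simp [inner, outer, hm, wpow_zero, List.replicate_succ]

theorem blocks_descent_early {m : ℕ} (hm : (3 * m) % 2 = 0) (hm2 : 2 ≤ m) {R : List Letter}
    (hR : [.b] ++ R = blocks (3 * m) (descent m (2 * m - 1) m)) (r : ℕ) (hr : r + 2 ≤ m) :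
    [.b] ++ ((List.Ico (m - r) m).flatMap
        (fun k => [.b] ++ wpow [.b, .a] k ++ wpow [.a, .b] m) ++ R) =
      blocks (3 * m) (descent m (2 * m - 1) (m + r)) := by
  induction r with
  | zero => simpa using hR
  | succ r ih =>
    -- The split-off a doubles the last a of the preceding (ba)^k, forming the entry block (0, 1).
    have h1 : wpow [.a, .b] m = [.a] ++ (wpow [.b, .a] (m - 1) ++ [.b]) := by
      have := append_wpow_comm [.b] [.a] (m - 1)
      simp only [List.singleton_append] at this
      rw [show [Letter.b, .a] = Letter.b :: [.a] from rfl, ← this]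
      obtain ⟨m, rfl⟩ := Nat.exists_eq_add_of_le' (show 1 ≤ m by omega)
      rw [wpow_succ]
      rfl
    rw [List.Ico.eq_cons (by omega), List.flatMap_cons, ← add_assoc, descent, if_neg (by omega),
      if_neg (by omega), blocks_append, blocks_append, blocks_cons, blocks_cons,
      blocks_replicate hm, blocks_replicate hm, ← ih (by omega),
      show m - (r + 1) + 1 = m - r by omega, h1,
      show m - (r + 1) = 1 + (2 * m - 1 - 2 - (m + r) + 1) by omega, wpow_add, wpow_add,
      wpow_succ _ 0]
    simp [inner, outer, hm, wpow_zero, List.replicate_succ]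

theorem explicitWord_append {m : ℕ} (hm : (3 * m) % 2 = 0) (hm2 : 2 ≤ m) :
    explicitWord (3 * m) ++ [outer (3 * m)] = blocks (3 * m) (optimal m (2 * m - 1)) := by
  have h := blocks_descent_early hm hm2 (blocks_descent_middle hm hm2) (m - 2) (by omega)
  rw [show m - (m - 2) = 2 by omega, show m + (m - 2) = 2 * m - 1 - 1 by omega] at h
  have h2 := append_wpow_comm [.b] [.a] (m - 1)
  rw [optimal, blocks_append, blocks_replicate hm, ← h, explicitWord,
    show 3 * m / 3 = m by omega, show 2 * (3 * m) / 3 = 2 * m by omega]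
  simp only [List.append_assoc, List.cons_append, List.nil_append] at h2 ⊢
  rw [show ∀ X : List Letter, Letter.b :: (wpow [.a, .b] (m - 1) ++ X) =
    wpow [.b, .a] (m - 1) ++ (.b :: X) from fun X => by
      rw [← List.cons_append, h2, List.append_assoc]; rfl]
  simp [outer, hm]

/-- Rounding occurs only for n ≡ 1 modulo 3; otherwise the expression is an integer. -/
theorem ceil_eq {n K : ℕ} (hn : 3 ≤ n) (hK : n / 3 + K = n - 1) :
    ⌈(2 / 3 : ℚ) * n * ((n : ℚ) - 2) - 1⌉ = 2 * ((n / 3 : ℕ) * (2 * K - (n / 3 : ℕ)) : ℤ) - 1 := by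
  obtain ⟨m, hm⟩ : ∃ m, m = n / 3 := ⟨_, rfl⟩
  rw [← hm] at hK ⊢
  rw [Int.ceil_eq_iff]
  rcases (by omega : n = 3 * m ∨ n = 3 * m + 1 ∨ n = 3 * m + 2) with rfl | rfl | rfl
  · have : (K : ℚ) = 2 * m - 1 := by
      have : (K : ℤ) = 2 * m - 1 := by omega
      exact_mod_cast this
    push_cast
    rw [this]
    constructor <;> linarith
  · obtain rfl : K = 2 * m := by omega
    push_cast
    constructor <;> linarith
  · obtain rfl : K = 2 * m + 1 := by omega
    push_cast
    constructor <;> linarith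

end SwitchCount

theorem mainTheorem1 (n : ℕ) (hn : 3 ≤ n) :
    SwitchCount.HasSwitchCount (SwitchCount.A n) ⌈(2 / 3 : ℚ) * n * ((n : ℚ) - 2) - 1⌉₊ ∧
    (∀ w : List SwitchCount.Letter, SwitchCount.IsSynchronizing (SwitchCount.A n) w →
      ⌈(2 / 3 : ℚ) * n * ((n : ℚ) - 2) - 1⌉ ≤ (SwitchCount.wordSwitchCount w : ℤ)) ∧
    (∃! w : List SwitchCount.Letter, SwitchCount.IsShortestMinimal (SwitchCount.A n) w) ∧
    (∀ w : List SwitchCount.Letter, SwitchCount.IsShortestMinimal (SwitchCount.A n) w →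
      (SwitchCount.wordSwitchCount w : ℤ) = ⌈(2 / 3 : ℚ) * n * ((n : ℚ) - 2) - 1⌉) ∧
    (6 ∣ n → SwitchCount.IsShortestMinimal (SwitchCount.A n) (SwitchCount.explicitWord n)) := by
  obtain ⟨K, hK⟩ : ∃ K, n / 3 + K = n - 1 := ⟨n - 1 - n / 3, by omega⟩
  obtain ⟨u, -, hu⟩ := SwitchCount.exists_blocks_optimal n (n / 3) K
  obtain ⟨hc, hw⟩ := SwitchCount.isShortestMinimal_iff hn hK hu
  have hs := SwitchCount.isSynchronizing_of_append hn hK hu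
  generalize SwitchCount.blocks n u ++ List.replicate 2 (SwitchCount.inner n) = w at *
  have hceil := SwitchCount.ceil_eq hn hK
  have hceil' : ⌈(2 / 3 : ℚ) * n * ((n : ℚ) - 2) - 1⌉₊ = SwitchCount.wordSwitchCount w := by
    rw [← Int.ceil_toNat, hceil, ← hc, Int.toNat_natCast]
  refine ⟨⟨⟨w, hs, hceil'.symm⟩, ?_⟩, fun v hv => ?_, ⟨w, (hw w).2 rfl, fun v => (hw v).1⟩,
    fun v hv => ?_, fun h6 => ?_⟩
  · rintro _ ⟨v, hv, rfl⟩
    have := (SwitchCount.le_wordSwitchCount hn hK hv).1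
    omega
  · rw [hceil]
    exact (SwitchCount.le_wordSwitchCount hn hK hv).1
  · rw [(hw v).1 hv, hc, hceil]
  · obtain ⟨t, rfl⟩ := h6
    have h := SwitchCount.explicitWord_append (m := 2 * t) (by omega) (by omega)
    rw [show 3 * (2 * t) = 6 * t by ring] at h
    rw [show 6 * t / 3 = 2 * t by omega] at hu hK
    obtain rfl : K = 2 * (2 * t) - 1 := by omega
    exact (hw _).2 (List.append_cancel_right (h.trans hu.symm))
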